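/- Let $M$ be a closed connected smooth $n$-manifold with universal cover $\mathsf p:\widetilde M\to M$, let $\pi:X=T^*M\to M$ be its cotangent bundle with Liouville form $\lambda_0$ ($(\lambda_0)_{(q,p)}(v)=p(d\pi\, v)$), let $\sigma$ be a smooth closed $2$-form on $M$, put $\widetilde\sigma=\mathsf p^*\sigma$ and $\omega_\sigma=d\lambda_0+\pi^*\sigma$, and denote lifts to $\widetilde X=T^*\widetilde M$ by a tilde. A function $H\in C^\infty(X,\mathbb R)$ is Tonelli if its second derivative along each fibre $T_q^*M$ is positive definite and $H(q,p)/|p|\to\infty$ as $|p|\to\infty$, uniformly in $q$. A compact connected hypersurface $\Sigma\subset X$ is a Tonelli hypersurface if $\Sigma=H^{-1}(0)$ for a Tonelli $H$ with regular value $0$; such an $H$ is called a defining Tonelli Hamiltonian for $\Sigma$. Let $S\subset M$ be a closed connected embedded submanifold, with base point $\star\in S$, such that $\pi_1(S,\star)\to\pi_1(M,\star)$ is injective and $\sigma|_S=0$. Define: - $\Omega^1_S(\widetilde\sigma)$: the smooth $1$-forms $\theta$ on $\widetilde M$ with $d\theta=\widetilde\sigma$ and $\theta|_{\mathsf p^{-1}(S)}=ds$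 for some bounded smooth function $s$ on $\mathsf p^{-1}(S)$; - $\Omega^1_\Sigma(\widetilde\sigma)$: the smooth $1$-forms $\theta$ on $\widetilde M$ with $d\theta=\widetilde\sigma$ such that $\lambda_\theta=\widetilde\lambda_0+\widetilde\pi^*\theta$, as a form on the preimage $\widetilde\Sigma\subset\widetilde X$ of $\Sigma$, is bounded with respect to the lift of a Riemannian metric, and $\inf_{\widetilde\Sigma}\lambda_\theta(X_{\widetilde H})>0$ for a defining Tonelli Hamiltonian $H$ of $\Sigma$, where $X_{\widetilde H}$ is given by $i_{X_{\widetilde H}}\widetilde\omega_\sigma=-d\widetilde H$; - $c(H,\sigma,S)=\inf_{\theta\in\Omega^1_S(\widetilde\sigma)}\sup_{q\in\widetilde M}\widetilde H(q,-\theta_q)$, which is $\infty$ if $\Omega^1_S(\widetilde\sigma)=\emptyset$. Assume that $\Sigma$ is a Tonelli hypersurface, $S$ is as above, and $(\Sigma,S)$ is a Mañé supercritical pair in either of the following two senses: (i) $\Omega^1_\Sigma(\widetilde\sigma)\cap\Omega^1_S(\widetilde\sigma)\neq\emptyset$; or (ii) $c(H,\sigma,S)<0$ for some defining Tonelli Hamiltonian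 $H$ of $\Sigma$. Let $N^*S=\{(q,p)\in X: q\in S,\ p|_{T_qS}=0\}$. Then every smooth map $f:S^1\times[0,1]\to X$ with $f(S^1\times\{0,1\})\subseteq N^*S$ satisfies $$\int_{S^1\times[0,1]}f^*\omega_\sigma=0 .$$ Consequently, Condition A holds for every class $\alpha\in\Pi_S=\pi_1(S,\star)\backslash\pi_1(M,\star)/\pi_1(S,\star)$. That is, $\int_{S^1\times[0,1]}f^*\omega_\sigma=0$ for every smooth loop $f:S^1\to P_\alpha(X,N^*S)$, regarded as a smooth map $f:S^1\times[0,1]\to X$. Here $P_\alpha(X,N^*S)$ is the set of smooth paths $x:[0,1]\to X$ with end points in $N^*S$ such that $\pi\circ x$, closed up by paths in $S$ from $\star$ to $\pi(x(0))$ and from $\pi(x(1))$ to $\star$, represents $\alpha$. -/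

import Mathlib

open scoped Manifold ContDiff Topology

noncomputable section

namespace TwistedCotangent

/-! Differential forms on smooth manifolds without boundary. -/

section Forms

variable {E : Type*} [NormedAddCommGroup E] [NormedSpace ℝ E]
  {H : Type*} [TopologicalSpace H] (I : ModelWithCorners ℝ E H)
  {E' : Type*} [NormedAddCommGroup E'] [NormedSpace ℝ E']
  {H' : Type*} [TopologicalSpace H'] (I' : ModelWithCorners ℝ E' H')
  {N : Type*} [TopologicalSpace N] [ChartedSpace H N]
  {N' : Type*} [TopologicalSpace N'] [ChartedSpace H' N']

variable (N) in
/-- Differential `k`-forms on `N` (no regularity). -/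
abbrev DForm (k : ℕ) : Type _ :=
  ∀ x : N, (TangentSpace I x) [⋀^Fin k]→L[ℝ] ℝ

variable (N) in
/-- Differential `1`-forms, written as fields of covectors (no regularity). -/
abbrev OneForm : Type _ :=
  ∀ x : N, TangentSpace I x →L[ℝ] ℝ

variable {I} in
/-- A `1`-form, regarded as an alternating form of degree one. -/
def OneForm.toDForm (θ : OneForm I N) : DForm I N 1 :=
  fun x => ContinuousAlternatingMap.ofSubsingleton ℝ (TangentSpace I x) ℝ (0 : Fin 1) (θ x)

variable {I'} in
/-- The pullback `f^* η`. -/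
def DForm.pullback {k : ℕ} (f : N → N') (η : DForm I' N' k) : DForm I N k :=
  fun x => (η (f x)).compContinuousLinearMap (mfderiv I I' f x)

variable {I} in
/-- The expression of a form in the preferred chart at `x₀`: its pullback under the inverse of
that chart. Meaningful on the target of the chart (open when `N` has no boundary). -/
def DForm.inChart {k : ℕ} (η : DForm I N k) (x₀ : N) : E → E [⋀^Fin k]→L[ℝ] ℝ :=
  DForm.pullback 𝓘(ℝ, E) (extChartAt I x₀).symm η

variable {I} in
/-- A form is smooth if its expression in every preferred chart is smooth. -/
def DForm.IsSmooth {k : ℕ} (η : DForm I N k) : Prop :=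
  ∀ x₀ : N, ContDiffOn ℝ ∞ (η.inChart x₀) (extChartAt I x₀).target

variable {I} in
/-- The exterior derivative `d η`, computed at `x` in the chart at `x` (it is chart independent
for smooth forms). -/
def DForm.d {k : ℕ} (η : DForm I N k) : DForm I N (k + 1) :=
  fun x => DForm.pullback (I' := 𝓘(ℝ, E)) I (extChartAt I x) (extDeriv (η.inChart x)) x

variable {I} in
/-- The smooth `1`-form `θ` is a primitive of the `2`-form `τ`. -/
def IsPrimitive (θ : OneForm I N) (τ : DForm I N 2) : Prop :=
  θ.toDForm.IsSmooth ∧ θ.toDForm.d = τ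

/-- The map `ℝ × ℝ → N` given by `(s, t) ↦ f (e^{2πis}, t)` for `0 ≤ t ≤ 1`. -/
def cylinderParam (f : Circle × unitInterval → N) : ℝ × ℝ → N :=
  fun z => f (Circle.exp (2 * Real.pi * z.1), Set.projIcc 0 1 zero_le_one z.2)

variable {I} in
/-- The integral `∫_{S^1 × [0,1]} f^* η`, in the coordinates `(s, t) ∈ [0,1] × [0,1]`. -/
def cylinderIntegral (η : DForm I N 2) (f : Circle × unitInterval → N) : ℝ :=
  ∫ s in (0 : ℝ)..1, ∫ t in (0 : ℝ)..1,
    let F := cylinderParam f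
    let D := mfderivWithin 𝓘(ℝ, ℝ × ℝ) I F (Set.univ ×ˢ Set.Icc 0 1) (s, t)
    η (F (s, t)) ![D ((1, 0) : ℝ × ℝ), D ((0, 1) : ℝ × ℝ)]

/-- Smoothness of a cylinder `S^1 × [0,1] → N`. -/
def IsSmoothCylinder (f : Circle × unitInterval → N) : Prop :=
  ContMDiff ((𝓡 1).prod (𝓡∂ 1)) I ∞ f

end Forms

/-! Cotangent bundles. -/

section Cotangent

/-- The model vector space `ℝ^n`. -/
abbrev Eucl (m : ℕ) : Type := EuclideanSpace ℝ (Fin m)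

variable (n : ℕ)
  (N : Type*) [TopologicalSpace N] [ChartedSpace (Eucl n) N] [IsManifold (𝓡 n) ∞ N]

/-- The cotangent bundle `T^*N`; a point `x` is a pair of `x.proj : N` and a covector `x.2`. -/
abbrev Cotangent : Type _ :=
  Bundle.TotalSpace (Eucl n →L[ℝ] ℝ) (fun q : N => TangentSpace (𝓡 n) q →L[ℝ] ℝ)

/-- The model of the manifold `T^*N`. -/
abbrev cotModel : ModelWithCorners ℝ (Eucl n × (Eucl n →L[ℝ] ℝ))
    (ModelProd (Eucl n) (Eucl n →L[ℝ] ℝ)) :=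
  (𝓡 n).prod 𝓘(ℝ, Eucl n →L[ℝ] ℝ)

/-- Smooth Riemannian metrics on `N`. -/
abbrev Metric : Type _ :=
  Bundle.ContMDiffRiemannianMetric (𝓡 n) ∞ (Eucl n) (fun q : N => TangentSpace (𝓡 n) q)

/-- Smooth Riemannian metrics on the manifold `T^*N`. -/
abbrev CotMetric : Type _ :=
  Bundle.ContMDiffRiemannianMetric (cotModel n) ∞ (Eucl n × (Eucl n →L[ℝ] ℝ))
    (fun x : Cotangent n N => TangentSpace (cotModel n) x)

variable {n N}

/-- The differential of the footpoint projection `π : T^*N → N`. -/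
def dProj (x : Cotangent n N) : TangentSpace (cotModel n) x →L[ℝ] TangentSpace (𝓡 n) x.proj :=
  mfderiv (cotModel n) (𝓡 n) (fun y : Cotangent n N => y.proj) x

/-- The Liouville form `λ₀` on `T^*N`, i.e. `(λ₀)_{(q,p)}(v) = p (dπ v)`. -/
def liouville : OneForm (cotModel n) (Cotangent n N) :=
  fun x => x.2.comp (dProj x)

/-- The twisted symplectic form `ω_σ = d λ₀ + π^* σ`. -/
def twistedForm (σ : DForm (𝓡 n) N 2) : DForm (cotModel n) (Cotangent n N) 2 :=
  fun x => liouville.toDForm.d x +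
    DForm.pullback (cotModel n) (fun y : Cotangent n N => y.proj) σ x

/-- The `1`-form `λ_θ = λ₀ + π^* θ`. -/
def lambdaForm (θ : OneForm (𝓡 n) N) : OneForm (cotModel n) (Cotangent n N) :=
  fun x => liouville x + (θ x.proj).comp (dProj x)

/-- `X` is the symplectic gradient of `H`, i.e. `i_X η = -dH`. -/
def IsSymplecticGradient (η : DForm (cotModel n) (Cotangent n N) 2) (H : Cotangent n N → ℝ)
    (X : ∀ x : Cotangent n N, TangentSpace (cotModel n) x) : Prop :=
  ∀ (x : Cotangent n N) (w : TangentSpace (cotModel n) x),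
    η x ![X x, w] = -(mfderiv (cotModel n) 𝓘(ℝ, ℝ) H x w : ℝ)

/-- The norm of a covector with respect to a Riemannian metric. -/
def coNorm (g : Metric n N) (q : N) (p : TangentSpace (𝓡 n) q →L[ℝ] ℝ) : ℝ :=
  sSup {r : ℝ | ∃ v : TangentSpace (𝓡 n) q, g.inner q v v ≤ 1 ∧ r = |p v|}

/-- Tonelli Hamiltonians: smooth, fibrewise strictly convex (positive definite second fibre
derivative) and superlinear, uniformly in the base point. -/
structure IsTonelli (H : Cotangent n N → ℝ) : Prop where
  smooth : ContMDiff (cotModel n) 𝓘(ℝ, ℝ) ∞ H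
  convex : ∀ (q : N) (p w : TangentSpace (𝓡 n) q →L[ℝ] ℝ), w ≠ 0 →
    0 < iteratedDeriv 2 (fun s : ℝ => H ⟨q, p + s • w⟩) 0
  superlinear : ∃ g : Metric n N, ∀ A : ℝ, ∃ R : ℝ,
    ∀ (q : N) (p : TangentSpace (𝓡 n) q →L[ℝ] ℝ),
      R ≤ coNorm g q p → A * coNorm g q p ≤ H ⟨q, p⟩

/-- `H` is a defining Tonelli Hamiltonian for `Σ`. -/
structure IsDefiningTonelli (H : Cotangent n N → ℝ) (Sig : Set (Cotangent n N)) : Prop where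
  tonelli : IsTonelli H
  regular : ∀ x, H x = 0 → mfderiv (cotModel n) 𝓘(ℝ, ℝ) H x ≠ 0
  eq_zeroSet : Sig = {x | H x = 0}

/-- Tonelli hypersurfaces: closed (compact) connected regular zero sets of Tonelli
Hamiltonians. -/
structure IsTonelliHypersurface (Sig : Set (Cotangent n N)) : Prop where
  compact : IsCompact Sig
  connected : IsConnected Sig
  exists_defining : ∃ H, IsDefiningTonelli H Sig

end Cotangent

/-! The universal cover and Mañé supercritical pairs. -/

section Pairs

variable {n d : ℕ}
  {M : Type*} [TopologicalSpace M] [ChartedSpace (Eucl n) M] [IsManifold (𝓡 n) ∞ M]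
  {U : Type*} [TopologicalSpace U] [ChartedSpace (Eucl n) U] [IsManifold (𝓡 n) ∞ U]
  {S : Type*} [TopologicalSpace S] [ChartedSpace (Eucl d) S] [IsManifold (𝓡 d) ∞ S]

/-- `p : U → M` is the universal cover of the smooth manifold `M`. -/
structure IsSmoothUniversalCover (p : U → M) : Prop where
  simplyConnected : SimplyConnectedSpace U
  covering : IsCoveringMap p
  localDiffeo : IsLocalDiffeomorph (𝓡 n) (𝓡 n) ∞ p

/-- The covering map `T^*U → T^*M`, `(q, ξ) ↦ (p q, ξ ∘ (dp_q)⁻¹)`, induced by a local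
diffeomorphism `p`. It identifies `T^*U` with the universal cover of `T^*M`. -/
def cotLift (p : U → M) (x : Cotangent n U) : Cotangent n M :=
  ⟨p x.proj, x.2.comp (mfderiv (𝓡 n) (𝓡 n) p x.proj).inverse⟩

/-- The set `Ω_Σ^1(σ̃)` of primitives `θ` of `σ̃ = p^* σ` for which `λ_θ` is bounded on the
preimage of `Σ` in `T^*U` (as a form on that hypersurface, for the lift of a metric), and
`λ_θ` is bounded below by a positive constant there along the lift of a positively oriented
section of the characteristic line bundle (the symplectic gradient of a defining
Hamiltonian). -/
def primitivesHyp (p : U → M) (σ : DForm (𝓡 n) M 2) (Sig : Set (Cotangent n M)) :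
    Set (OneForm (𝓡 n) U) :=
  {θ | IsPrimitive θ (DForm.pullback (𝓡 n) p σ) ∧
    ∃ H : Cotangent n M → ℝ, IsDefiningTonelli H Sig ∧
      (∃ (g : CotMetric n M) (C : ℝ), ∀ x : Cotangent n U, cotLift p x ∈ Sig →
        ∀ v : TangentSpace (cotModel n) x,
          mfderiv (cotModel n) 𝓘(ℝ, ℝ) (H ∘ cotLift p) x v = 0 →
          |lambdaForm θ x v| ≤ C * Real.sqrt (g.inner (cotLift p x)
            (mfderiv (cotModel n) (cotModel n) (cotLift p) x v)
            (mfderiv (cotModel n) (cotModel n) (cotLift p) x v))) ∧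
      (∃ (X : ∀ x : Cotangent n U, TangentSpace (cotModel n) x) (ε : ℝ),
        IsSymplecticGradient (twistedForm (DForm.pullback (𝓡 n) p σ)) (H ∘ cotLift p) X ∧
        0 < ε ∧ ∀ x : Cotangent n U, cotLift p x ∈ Sig → ε ≤ lambdaForm θ x (X x))}

/-- The set `Ω_S^1(σ̃)` of primitives `θ` of `σ̃ = p^* σ` whose restriction to the submanifold
`p⁻¹(S)` is `ds` for a bounded smooth function `s` on `p⁻¹(S)`. The submanifold `S` is given by
its embedding `i`; only the values of `s` on `p⁻¹(S)` matter, and that `θ_x` is a derivative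
of `s` at `x` within `p⁻¹(S)` says that `θ_x` and `ds_x` agree on `T_x p⁻¹(S)`. -/
def primitivesSub (p : U → M) (σ : DForm (𝓡 n) M 2) (i : S → M) : Set (OneForm (𝓡 n) U) :=
  {θ | IsPrimitive θ (DForm.pullback (𝓡 n) p σ) ∧
    ∃ s : U → ℝ, ContMDiffOn (𝓡 n) 𝓘(ℝ, ℝ) ∞ s (p ⁻¹' Set.range i) ∧
      (∃ C : ℝ, ∀ x ∈ p ⁻¹' Set.range i, |s x| ≤ C) ∧
      ∀ x ∈ p ⁻¹' Set.range i,
        HasMFDerivWithinAt (𝓡 n) 𝓘(ℝ, ℝ) s (p ⁻¹' Set.range i) x (θ x)}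

/-- The critical value `c(H, σ, S) = inf_θ sup_q H̃(q, -θ_q)`, the infimum being over
`θ ∈ Ω_S^1(σ̃)`; it is `∞` if there is no such `θ`. -/
def criticalValue (p : U → M) (σ : DForm (𝓡 n) M 2) (i : S → M) (H : Cotangent n M → ℝ) : EReal :=
  ⨅ θ ∈ primitivesSub p σ i, ⨆ q : U, ((H (cotLift p ⟨q, -θ q⟩) : ℝ) : EReal)

/-- The standing assumptions on a pair `(Σ, S)`: `Σ` is a Tonelli hypersurface, and `S`
(given by `i : S → M`, with base point `s₀`) is a closed connected `π₁`-injective submanifold with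
`σ|_S = 0`. -/
structure IsPair (σ : DForm (𝓡 n) M 2) (i : C(S, M)) (s₀ : S) (Sig : Set (Cotangent n M)) :
    Prop where
  tonelli : IsTonelliHypersurface Sig
  compact : CompactSpace S
  connected : ConnectedSpace S
  embedding : Manifold.IsSmoothEmbedding (𝓡 d) (𝓡 n) ∞ i
  injective : Function.Injective (FundamentalGroup.map i s₀)
  restrict_eq_zero : DForm.pullback (𝓡 d) i σ = 0

/-- Mañé supercritical pairs, first definition: `Ω_Σ^1(σ̃) ∩ Ω_S^1(σ̃) ≠ ∅`. -/
structure IsManePair (p : U → M) (σ : DForm (𝓡 n) M 2) (i : C(S, M)) (s₀ : S)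
    (Sig : Set (Cotangent n M)) : Prop extends IsPair (d := d) σ i s₀ Sig where
  nonempty : (primitivesHyp p σ Sig ∩ primitivesSub p σ i).Nonempty

/-- Mañé supercritical pairs, second definition: `c(H, σ, S) < 0` for some defining Tonelli
Hamiltonian `H` of `Σ`. -/
structure IsManePairCritical (p : U → M) (σ : DForm (𝓡 n) M 2) (i : C(S, M)) (s₀ : S)
    (Sig : Set (Cotangent n M)) : Prop extends IsPair (d := d) σ i s₀ Sig where
  critical : ∃ H, IsDefiningTonelli H Sig ∧ criticalValue p σ i H < 0

/-- The conormal bundle `N^*S ⊆ T^*M`. -/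
def conormal (i : S → M) : Set (Cotangent n M) :=
  {x | ∃ (a : S) (ξ : TangentSpace (𝓡 n) (i a) →L[ℝ] ℝ), x = ⟨i a, ξ⟩ ∧
    ∀ v : TangentSpace (𝓡 d) a, ξ (mfderiv (𝓡 d) (𝓡 n) i a v) = 0}

/-- `Π_S = π₁(S) \ π₁(M) / π₁(S)`. -/
abbrev PiS (i : C(S, M)) (s₀ : S) : Type _ :=
  DoubleCoset.Quotient
    ((FundamentalGroup.map i s₀).range : Set (FundamentalGroup M (i s₀)))
    ((FundamentalGroup.map i s₀).range : Set (FundamentalGroup M (i s₀)))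

/-- The path `c`, with end points in `S`, lies in the component of the space of such paths that
corresponds to `α ∈ Π_S`: closing `c` up with paths inside `S` from and to the base point gives a
loop that represents `α`. -/
def InComponent (i : C(S, M)) (s₀ : S) (α : PiS i s₀) (c : unitInterval → M) : Prop :=
  ∃ (a b : S) (γ₀ : Path s₀ a) (γ₁ : Path b s₀) (γ : Path (i a) (i b)),
    (∀ t, γ t = c t) ∧
    (DoubleCoset.mk (FundamentalGroup.map i s₀).range (FundamentalGroup.map i s₀).range
      (FundamentalGroup.fromPath
        (Path.Homotopic.Quotient.mk
          ((γ₀.map i.continuous).trans (γ.trans (γ₁.map i.continuous)))))) = α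

/-- Condition A for the class `α`: every smooth loop of paths in `P_α(T^*M, N^*S)`, regarded as
a cylinder `f : S^1 × [0,1] → T^*M` with boundary on `N^*S`, has zero `ω_σ`-area. -/
def ConditionA (σ : DForm (𝓡 n) M 2) (i : C(S, M)) (s₀ : S) (α : PiS i s₀) : Prop :=
  ∀ f : Circle × unitInterval → Cotangent n M, IsSmoothCylinder (cotModel n) f →
    (∀ z, f (z, 0) ∈ conormal (d := d) i ∧ f (z, 1) ∈ conormal (d := d) i) →
    (∀ z, InComponent i s₀ α (fun t => (f (z, t)).proj)) →
    cylinderIntegral (twistedForm σ) f = 0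

end Pairs

end TwistedCotangent

end

/-! Since `ω_σ = dλ₀ + π^*σ`, the area of a cylinder `f` with boundary on `N^*S` splits into two
parts, which vanish for different reasons. The computations take place on the strip `ℝ × [0,1]`, the
universal cover of the cylinder, with Stokes' theorem on rectangles (`integral_pullbackWithin_d`).

The `dλ₀` part: Stokes leaves integrals of `λ₀` over the four sides. The two vertical sides cancel
by periodicity. On the horizontal sides the footpoint moves in the embedded `S`, so its velocity is
tangent to `S` and is killed by covectors of `N^*S` (`integral_d_liouville_eq_zero`).

The `σ` part: lift the strip of `u = π ∘ f` to the universal cover, where `σ̃ = dθ`. The area `A` of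
`u` is multiplied by `k` on the rectangle `[0,k] × [0,1]`. By Stokes the area there is a boundary
integral. On the horizontal sides `θ` is the differential of a bounded function, so they contribute
a bounded amount whatever their length; the vertical sides are lifts of one fixed path in `M`, so
they are bounded too as soon as `θ` is bounded over compact subsets of `M`. Thus `k|A|` is bounded
independently of `k`, and `A = 0` (`integral_pullbackWithin_eq_zero`).

It remains to find such a bounded `θ` in `Ω_S^1(σ̃)`. In sense (ii) some `θ` has `H̃(q, -θ_q) < 0`
everywhere, and superlinearity of `H` bounds `θ`. In sense (i) positivity of `λ_θ` on the symplectic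
gradient shows that `Σ` has no point where `H` is critical along the fibre. Hence `Σ → M` is a
submersion, onto by compactness, and tangent vectors of `M` lift to `Σ` with local bounds.
Boundedness of `λ_θ` on these lifts, less the bounded contribution of the covector, bounds `θ`
(`isLocallyBoundedOver_of_mem_primitivesHyp`). -/

noncomputable section

namespace TwistedCotangent

/-! ### Pullbacks of forms to subsets of vector spaces, and Stokes' theorem on rectangles. -/

section Stokes

open Set MeasureTheory

variable {E : Type*} [NormedAddCommGroup E] [NormedSpace ℝ E]
  {H : Type*} [TopologicalSpace H] {I : ModelWithCorners ℝ E H} [I.Boundaryless]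
  {N : Type*} [TopologicalSpace N] [ChartedSpace H N] [IsManifold I ∞ N]
  {V : Type*} [NormedAddCommGroup V] [NormedSpace ℝ V]

/-- The pullback of a form under a map defined on a subset of a vector space. -/
def pullbackWithin {k : ℕ} (η : DForm I N k) (F : V → N) (A : Set V) : V → V [⋀^Fin k]→L[ℝ] ℝ :=
  fun z => (η (F z)).compContinuousLinearMap (mfderivWithin 𝓘(ℝ, V) I F A z)

omit [I.Boundaryless] [IsManifold I ∞ N] in
-- All tangent spaces are definitionally the model space `E`, so base point and vectors can be
-- replaced separately, without transport between fibres.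
theorem DForm.apply_congr {k : ℕ} (η : DForm I N k) {x y : N} (h : x = y) {v w : Fin k → E}
    (hv : v = w) : (η x : E [⋀^Fin k]→L[ℝ] ℝ) v = (η y : E [⋀^Fin k]→L[ℝ] ℝ) w := by
  subst h hv; rfl

/-- The coordinate expression of a pullback. -/
theorem pullbackWithin_eq_inChart {k : ℕ} (η : DForm I N k) {F : V → N} {A : Set V} {z : V}
    (hF : MDifferentiableWithinAt 𝓘(ℝ, V) I F A z) (hA : UniqueDiffWithinAt ℝ A z) (hz : z ∈ A)
    {x₀ : N} (hx : F z ∈ (chartAt H x₀).source) :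
    pullbackWithin η F A z = (η.inChart x₀ (extChartAt I x₀ (F z))).compContinuousLinearMap
      (fderivWithin ℝ (extChartAt I x₀ ∘ F) A z) := by
  have hx' : F z ∈ (extChartAt I x₀).source := by rwa [extChartAt_source]
  have hsymm : (extChartAt I x₀).symm (extChartAt I x₀ (F z)) = F z :=
    (extChartAt I x₀).left_inv hx'
  have hUA : UniqueMDiffWithinAt 𝓘(ℝ, V) A z := hA.uniqueMDiffWithinAt
  have h1 : MDifferentiableWithinAt 𝓘(ℝ, V) 𝓘(ℝ, E) (extChartAt I x₀ ∘ F) A z :=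
    (mdifferentiableAt_extChartAt hx).comp_mdifferentiableWithinAt z hF
  have h2 : MDifferentiableAt 𝓘(ℝ, E) I (extChartAt I x₀).symm ((extChartAt I x₀ ∘ F) z) :=
    ((contMDiffOn_extChartAt_symm (n := ∞) x₀).contMDiffAt
      (extChartAt_target_mem_nhds' ((extChartAt I x₀).map_source hx'))).mdifferentiableAt (by simp)
  have hev : F =ᶠ[𝓝[A] z] (extChartAt I x₀).symm ∘ (extChartAt I x₀ ∘ F) := by
    have := hF.continuousWithinAt.preimage_mem_nhdsWithin
      ((isOpen_extChartAt_source (I := I) x₀).mem_nhds hx')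
    filter_upwards [this] with w hw
    exact ((extChartAt I x₀).left_inv hw).symm
  have hD : (mfderivWithin 𝓘(ℝ, V) I F A z : V →L[ℝ] E) =
      (mfderiv 𝓘(ℝ, E) I (extChartAt I x₀).symm (extChartAt I x₀ (F z)) : E →L[ℝ] E).comp
        (fderivWithin ℝ (extChartAt I x₀ ∘ F) A z) := by
    have e1 := (hev.mfderivWithin_eq (I := 𝓘(ℝ, V)) (I' := I) (hev.self_of_nhdsWithin hz))
    have e2 := mfderiv_comp_mfderivWithin (I := 𝓘(ℝ, V)) (I' := 𝓘(ℝ, E)) (I'' := I) z h2 h1 hUA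
    exact e1.trans (e2.trans (by rw [mfderivWithin_eq_fderivWithin]; rfl))
  ext v
  refine DForm.apply_congr η hsymm.symm ?_
  funext j
  exact congrArg (fun L : V →L[ℝ] E => L (v j)) hD

/-- In the chart at `F z` the pullback is the smooth coefficient of `η` composed with the derivative
of the coordinate expression of `F`. In degree one this is a composition of linear maps, via the
isometry with covectors. -/
theorem contDiffOn_pullbackWithin {η : DForm I N 1} (hη : η.IsSmooth) {F : V → N}
    {A : Set V} (hF : ContMDiffOn 𝓘(ℝ, V) I ∞ F A) (hA : UniqueDiffOn ℝ A) :
    ContDiffOn ℝ ∞ (pullbackWithin η F A) A := by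
  intro z hz
  set x₀ := F z
  have hmem : ∀ᶠ w in 𝓝[A] z, F w ∈ (chartAt H x₀).source :=
    (hF z hz).continuousWithinAt.preimage_mem_nhdsWithin
      ((chartAt H x₀).open_source.mem_nhds (mem_chart_source H x₀))
  have hφ : ∀ᶠ w in 𝓝[A] z, ContDiffWithinAt ℝ ∞ (extChartAt I x₀ ∘ F) A w := by
    filter_upwards [hmem, self_mem_nhdsWithin] with w hw hwA
    exact ((contMDiffAt_extChartAt' hw).comp_contMDiffWithinAt w (hF w hwA)).contDiffWithinAt
  have hz0 := hφ.self_of_nhdsWithin hz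
  have h1 : ContDiffWithinAt ℝ ∞ (fderivWithin ℝ (extChartAt I x₀ ∘ F) A) A z :=
    hz0.fderivWithin_right (m := ∞) hA (by simp) hz
  have h2 : ContDiffWithinAt ℝ ∞ (fun w => η.inChart x₀ ((extChartAt I x₀ ∘ F) w)) A z := by
    have := (hη x₀).contDiffAt (x := extChartAt I x₀ (F z))
      (extChartAt_target_mem_nhds' (mem_extChartAt_target x₀))
    exact this.comp_contDiffWithinAt z hz0
  have h3 : ContDiffWithinAt ℝ ∞ (fun w => (η.inChart x₀ ((extChartAt I x₀ ∘ F) w)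
      ).compContinuousLinearMap (fderivWithin ℝ (extChartAt I x₀ ∘ F) A w)) A z := by
    have e (α : E [⋀^Fin 1]→L[ℝ] ℝ) (L : V →L[ℝ] E) : α.compContinuousLinearMap L =
        ContinuousAlternatingMap.ofSubsingletonLIE (𝕜 := ℝ) (E := V) (F := ℝ) (0 : Fin 1)
          (((ContinuousAlternatingMap.ofSubsingletonLIE (𝕜 := ℝ) (E := E) (F := ℝ) (0 : Fin 1)).symm α).comp L) := by
      obtain ⟨α, rfl⟩ := (ContinuousAlternatingMap.ofSubsingletonLIE (𝕜 := ℝ) (E := E) (F := ℝ) (0 : Fin 1)).surjective α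
      rw [LinearIsometryEquiv.symm_apply_apply]
      rfl
    simp only [e]
    exact (LinearIsometryEquiv.contDiff _).comp_contDiffWithinAt
      (((LinearIsometryEquiv.contDiff _).comp_contDiffWithinAt h2).clm_comp h1)
  refine h3.congr_of_eventuallyEq ?_ ?_
  · filter_upwards [hmem, self_mem_nhdsWithin] with w hw hwA
    exact pullbackWithin_eq_inChart η ((hF w hwA).mdifferentiableWithinAt (by simp)) (hA w hwA)
      hwA hw
  · exact pullbackWithin_eq_inChart η ((hF z hz).mdifferentiableWithinAt (by simp)) (hA z hz)
      hz (mem_chart_source H x₀)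

/-- Naturality of `d`, reduced to vector spaces by the chart at `F z`, the very chart in which `η.d`
is computed at `F z`. The closure condition makes the second derivative within `A` symmetric at
boundary points. -/
theorem pullbackWithin_d {k : ℕ} {η : DForm I N k} (hη : η.IsSmooth) {F : V → N}
    {A : Set V} (hF : ContMDiffOn 𝓘(ℝ, V) I ∞ F A) (hA : UniqueDiffOn ℝ A) {z : V} (hz : z ∈ A)
    (hz' : z ∈ closure (interior A)) :
    pullbackWithin η.d F A z = extDerivWithin (pullbackWithin η F A) A z := by
  set x₀ := F z
  have hmem : ∀ᶠ w in 𝓝[A] z, F w ∈ (chartAt H x₀).source :=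
    (hF z hz).continuousWithinAt.preimage_mem_nhdsWithin
      ((chartAt H x₀).open_source.mem_nhds (mem_chart_source H x₀))
  have hφ : ContDiffWithinAt ℝ ∞ (extChartAt I x₀ ∘ F) A z :=
    ((contMDiffAt_extChartAt' (mem_chart_source H x₀)).comp_contMDiffWithinAt z
      (hF z hz)).contDiffWithinAt
  have hev : pullbackWithin η F A =ᶠ[𝓝[A] z] fun w => (η.inChart x₀ ((extChartAt I x₀ ∘ F) w)
      ).compContinuousLinearMap (fderivWithin ℝ (extChartAt I x₀ ∘ F) A w) := by
    filter_upwards [hmem, self_mem_nhdsWithin] with w hw hwA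
    exact pullbackWithin_eq_inChart η ((hF w hwA).mdifferentiableWithinAt (by simp)) (hA w hwA)
      hwA hw
  have hdiff : DifferentiableAt ℝ (η.inChart x₀) ((extChartAt I x₀ ∘ F) z) :=
    ((hη x₀).contDiffAt (x := extChartAt I x₀ (F z))
      (extChartAt_target_mem_nhds' (mem_extChartAt_target x₀))).differentiableAt (by simp)
  rw [hev.extDerivWithin_eq_of_mem hz, extDerivWithin_pullback (t := univ) (r := ∞)
    hdiff.differentiableWithinAt hφ (by simpa using WithTop.coe_le_coe.2 (le_top (a := (2 : ℕ∞)))) hA hz' hz (mapsTo_univ _ _),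
    extDerivWithin_univ]
  have hD : (fderivWithin ℝ (extChartAt I x₀ ∘ F) A z : V →L[ℝ] E) =
      (mfderiv I 𝓘(ℝ, E) (extChartAt I x₀) x₀ : E →L[ℝ] E).comp
        (mfderivWithin 𝓘(ℝ, V) I F A z : V →L[ℝ] E) := by
    rw [← mfderivWithin_eq_fderivWithin]
    exact mfderiv_comp_mfderivWithin (I := 𝓘(ℝ, V)) (I' := I) (I'' := 𝓘(ℝ, E)) z
      (mdifferentiableAt_extChartAt (mem_chart_source H x₀))
      ((hF z hz).mdifferentiableWithinAt (by simp)) (hA z hz).uniqueMDiffWithinAt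
  rw [hD]
  rfl

/-- The pullback of a `1`-form, as a field of covectors. -/
def pullbackCovector (θ : OneForm I N) (F : V → N) (A : Set V) : V → V →L[ℝ] ℝ :=
  fun z => (θ (F z)).comp (mfderivWithin 𝓘(ℝ, V) I F A z)

theorem contDiffOn_pullbackCovector {θ : OneForm I N} (hθ : θ.toDForm.IsSmooth) {F : V → N}
    {A : Set V} (hF : ContMDiffOn 𝓘(ℝ, V) I ∞ F A) (hA : UniqueDiffOn ℝ A) :
    ContDiffOn ℝ ∞ (pullbackCovector θ F A) A :=
  (LinearIsometryEquiv.contDiff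
    (ContinuousAlternatingMap.ofSubsingletonLIE (𝕜 := ℝ) (E := V) (F := ℝ) (0 : Fin 1)).symm).comp_contDiffOn
    (contDiffOn_pullbackWithin hθ hF hA)

theorem pullbackWithin_d_apply {θ : OneForm I N} (hθ : θ.toDForm.IsSmooth) {F : V → N}
    {A : Set V} (hF : ContMDiffOn 𝓘(ℝ, V) I ∞ F A) (hA : UniqueDiffOn ℝ A) {z : V} (hz : z ∈ A)
    (hz' : z ∈ closure (interior A)) (v w : V) :
    pullbackWithin θ.toDForm.d F A z ![v, w] =
      fderivWithin ℝ (pullbackCovector θ F A) A z v w -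
        fderivWithin ℝ (pullbackCovector θ F A) A z w v := by
  have hs := (contDiffOn_pullbackCovector hθ hF hA z hz).differentiableWithinAt (by simp)
  have hs' := (contDiffOn_pullbackWithin hθ hF hA z hz).differentiableWithinAt (by simp)
  have e : ∀ u : V, ∀ c : Fin 1 → V, c 0 = u → (fun y => pullbackWithin θ.toDForm F A y c) =
      fun y => pullbackCovector θ F A y u := by
    rintro u c rfl
    rfl
  rw [pullbackWithin_d hθ hF hA hz hz', extDerivWithin_apply hs' (hA z hz), Fin.sum_univ_two]
  rw [e w _ (by simp [Fin.removeNth]), e v _ (by simp [Fin.removeNth])]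
  have e2 (u c : V) : fderivWithin ℝ (fun y => pullbackCovector θ F A y u) A z c =
      fderivWithin ℝ (pullbackCovector θ F A) A z c u := by
    rw [fderivWithin_clm_apply (hA z hz) hs (differentiableWithinAt_const u)]
    simp
  rw [e2, e2]
  simp [sub_eq_add_neg]

/-- The strip `ℝ × [0,1]`. -/
def strip : Set (ℝ × ℝ) := univ ×ˢ Icc 0 1

theorem uniqueDiffOn_strip : UniqueDiffOn ℝ strip :=
  uniqueDiffOn_univ.prod (uniqueDiffOn_Icc zero_lt_one)

theorem interior_strip : interior strip = univ ×ˢ Ioo 0 1 := by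
  rw [strip, interior_prod_eq, interior_univ, interior_Icc]

theorem mem_closure_interior_strip {z : ℝ × ℝ} (hz : z ∈ strip) :
    z ∈ closure (interior strip) := by
  rw [interior_strip, closure_prod_eq, closure_univ, closure_Ioo zero_ne_one]
  exact hz

theorem continuousOn_pullbackWithin_d {θ : OneForm I N} (hθ : θ.toDForm.IsSmooth)
    {F : ℝ × ℝ → N} (hF : ContMDiffOn 𝓘(ℝ, ℝ × ℝ) I ∞ F strip) (v w : ℝ × ℝ) :
    ContinuousOn (fun z => pullbackWithin θ.toDForm.d F strip z ![v, w]) strip := by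
  have h := (contDiffOn_pullbackCovector hθ hF uniqueDiffOn_strip).continuousOn_fderivWithin
    uniqueDiffOn_strip (by simp)
  refine ContinuousOn.congr (f := fun z => fderivWithin ℝ (pullbackCovector θ F strip) strip z v w -
        fderivWithin ℝ (pullbackCovector θ F strip) strip z w v) ?_ fun z hz =>
    pullbackWithin_d_apply hθ hF uniqueDiffOn_strip hz (mem_closure_interior_strip hz) v w
  fun_prop

theorem continuousOn_pullbackCovector_apply {θ : OneForm I N} (hθ : θ.toDForm.IsSmooth)
    {F : ℝ × ℝ → N} (hF : ContMDiffOn 𝓘(ℝ, ℝ × ℝ) I ∞ F strip) (v : ℝ × ℝ) :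
    ContinuousOn (fun z => pullbackCovector θ F strip z v) strip :=
  (contDiffOn_pullbackCovector hθ hF uniqueDiffOn_strip).continuousOn.clm_apply continuousOn_const

/-- Stokes' theorem for a `1`-form pulled back to the rectangle `[a,b] × [0,1]`. -/
theorem integral_pullbackWithin_d {θ : OneForm I N} (hθ : θ.toDForm.IsSmooth)
    {F : ℝ × ℝ → N} (hF : ContMDiffOn 𝓘(ℝ, ℝ × ℝ) I ∞ F strip) (a b : ℝ) :
    ∫ s in a..b, ∫ t in (0 : ℝ)..1, pullbackWithin θ.toDForm.d F strip (s, t) ![(1, 0), (0, 1)] =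
      (((∫ s in a..b, -pullbackCovector θ F strip (s, 1) (1, 0)) -
        ∫ s in a..b, -pullbackCovector θ F strip (s, 0) (1, 0)) +
        ∫ t in (0 : ℝ)..1, pullbackCovector θ F strip (b, t) (0, 1)) -
        ∫ t in (0 : ℝ)..1, pullbackCovector θ F strip (a, t) (0, 1) := by
  set L := pullbackCovector θ F strip
  have hsub : uIcc a b ×ˢ uIcc (0 : ℝ) 1 ⊆ strip := by
    rw [uIcc_of_le (zero_le_one' ℝ)]
    exact prod_mono (subset_univ _) le_rfl
  -- The integrand is the divergence of the vector field `(L(∂_t), -L(∂_s))`, to which the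
  -- divergence theorem applies.
  have hpt : ∀ z ∈ strip, pullbackWithin θ.toDForm.d F strip z ![(1, 0), (0, 1)] =
      (fderivWithin ℝ L strip z).flip (0, 1) (1, 0) +
        (-(fderivWithin ℝ L strip z).flip (1, 0)) (0, 1) := fun z hz => by
    rw [pullbackWithin_d_apply hθ hF uniqueDiffOn_strip hz (mem_closure_interior_strip hz)]
    simp [L, sub_eq_add_neg]
  have hd : ∀ z ∈ Ioo (min a b) (max a b) ×ˢ Ioo (min (0 : ℝ) 1) (max 0 1), ∀ v,
      HasFDerivAt (fun z => L z v) ((fderivWithin ℝ L strip z).flip v) z := by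
    intro z hz v
    have hz' : z ∈ interior strip := by
      rw [interior_strip]
      refine ⟨mem_univ _, ?_⟩
      simpa using hz.2
    have hL := ((contDiffOn_pullbackCovector hθ hF uniqueDiffOn_strip).differentiableOn
      (by simp) z (interior_subset hz')).hasFDerivWithinAt.hasFDerivAt
      (mem_interior_iff_mem_nhds.1 hz')
    exact (hL.clm_apply (hasFDerivAt_const v z)).congr_fderiv (by ext <;> simp [L])
  have hc := continuousOn_pullbackCovector_apply hθ hF
  rw [← integral2_divergence_prod_of_hasFDerivAt (fun z => L z (0, 1)) (fun z => -L z (1, 0))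
    (fun z => (fderivWithin ℝ L strip z).flip (0, 1))
    (fun z => -(fderivWithin ℝ L strip z).flip (1, 0)) a 0 b 1 ((hc _).mono hsub)
    ((hc _).neg.mono hsub) (fun z hz => hd z hz _) (fun z hz => (hd z hz _).neg)]
  · refine intervalIntegral.integral_congr fun s _ => ?_
    refine intervalIntegral.integral_congr fun t ht => hpt _ ⟨mem_univ _, ?_⟩
    rwa [uIcc_of_le (zero_le_one' ℝ)] at ht
  · refine ContinuousOn.integrableOn_compact (isCompact_uIcc.prod isCompact_uIcc) ?_
    exact ((continuousOn_pullbackWithin_d hθ hF _ _).mono hsub).congr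
      fun z hz => (hpt z (hsub hz)).symm

end Stokes

/-! ### The canonical form `p dq` and its exterior derivative `dp ∧ dq`. -/

section CanonicalForm

variable (E : Type*) [NormedAddCommGroup E] [NormedSpace ℝ E]

/-- The form `p dq` on `E × E^*`. -/
def canonicalForm (z : E × (E →L[ℝ] ℝ)) : (E × (E →L[ℝ] ℝ)) [⋀^Fin 1]→L[ℝ] ℝ :=
  ContinuousAlternatingMap.ofSubsingleton ℝ (E × (E →L[ℝ] ℝ)) ℝ (0 : Fin 1)
    (z.2.comp (ContinuousLinearMap.fst ℝ E (E →L[ℝ] ℝ)))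

theorem contDiff_canonicalForm : ContDiff ℝ ∞ (canonicalForm E) :=
  (LinearIsometryEquiv.contDiff (ContinuousAlternatingMap.ofSubsingletonLIE (𝕜 := ℝ)
    (E := E × (E →L[ℝ] ℝ)) (F := ℝ) (0 : Fin 1))).comp
    (contDiff_snd.clm_comp contDiff_const)

theorem extDeriv_canonicalForm (z v w : E × (E →L[ℝ] ℝ)) :
    extDeriv (canonicalForm E) z ![v, w] = v.2 w.1 - w.2 v.1 := by
  have e (u c : E × (E →L[ℝ] ℝ)) :
      fderiv ℝ (fun z : E × (E →L[ℝ] ℝ) => z.2 u.1) z c = c.2 u.1 := by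
    have : HasFDerivAt (fun z : E × (E →L[ℝ] ℝ) => z.2 u.1)
      (((ContinuousLinearMap.apply ℝ ℝ u.1).comp (ContinuousLinearMap.snd ℝ E (E →L[ℝ] ℝ)))) z :=
      ((ContinuousLinearMap.apply ℝ ℝ u.1).comp
        (ContinuousLinearMap.snd ℝ E (E →L[ℝ] ℝ))).hasFDerivAt
    rw [this.fderiv]; rfl
  have e' (c : Fin 1 → E × (E →L[ℝ] ℝ)) (z : E × (E →L[ℝ] ℝ)) :
      canonicalForm E z c = z.2 (c 0).1 := rfl
  rw [extDeriv_apply ((contDiff_canonicalForm E).differentiable (by simp) z), Fin.sum_univ_two]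
  simp only [e', e]
  simp [Fin.removeNth, sub_eq_add_neg]

end CanonicalForm

/-! ### The Liouville form in the charts of the cotangent bundle. -/

section CotangentCharts

open Set Bundle

variable {n : ℕ} {N : Type*} [TopologicalSpace N] [ChartedSpace (Eucl n) N] [IsManifold (𝓡 n) ∞ N]

theorem extChartAt_cotangent_source (x₀ : Cotangent n N) :
    (extChartAt (cotModel n) x₀).source = {x | x.proj ∈ (chartAt (Eucl n) x₀.proj).source} := by
  ext x
  rw [FiberBundle.extChartAt]
  simp only [mfld_simps]
  exact ⟨fun h => h.1.1, fun h => ⟨⟨h, mem_univ _⟩, h⟩⟩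

theorem extChartAt_cotangent_apply_fst (x₀ x : Cotangent n N) :
    (extChartAt (cotModel n) x₀ x).1 = extChartAt (𝓡 n) x₀.proj x.proj := by
  rw [FiberBundle.extChartAt]
  rfl

/-- The fibre part of the cotangent chart is precomposition with the inverse differential of the
base chart, so pairing it with a pushed-forward vector gives back the original pairing. -/
theorem extChartAt_cotangent_apply_snd {x₀ x : Cotangent n N}
    (hx : x.proj ∈ (chartAt (Eucl n) x₀.proj).source) (v : TangentSpace (𝓡 n) x.proj) :
    (extChartAt (cotModel n) x₀ x).2 (mfderiv (𝓡 n) 𝓘(ℝ, Eucl n) (extChartAt (𝓡 n) x₀.proj) x.proj v)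
      = x.2 v := by
  have h : (extChartAt (cotModel n) x₀ x).2 =
      x.2.comp ((trivializationAt (Eucl n) (TangentSpace (𝓡 n)) x₀.proj).symmL ℝ x.proj) := by
    rw [FiberBundle.extChartAt]
    change ContinuousLinearMap.inCoordinates (Eucl n) (TangentSpace (𝓡 n)) ℝ (fun _ : N => ℝ)
      x₀.proj x.proj x₀.proj x.proj x.2 = _
    ext u
    simp [ContinuousLinearMap.inCoordinates]
  rw [h, ← TangentBundle.continuousLinearMapAt_trivializationAt hx]
  exact congrArg x.2 (Trivialization.symmL_continuousLinearMapAt (R := ℝ) (trivializationAt (Eucl n) (TangentSpace (𝓡 n)) x₀.proj) hx v)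

theorem extChartAt_cotangent_symm_proj {x₀ : Cotangent n N} {z : Eucl n × (Eucl n →L[ℝ] ℝ)}
    (hz : z ∈ (extChartAt (cotModel n) x₀).target) :
    ((extChartAt (cotModel n) x₀).symm z).proj = (extChartAt (𝓡 n) x₀.proj).symm z.1 := by
  have h1 := (extChartAt (cotModel n) x₀).map_target hz
  have h2 := extChartAt_cotangent_apply_fst x₀ ((extChartAt (cotModel n) x₀).symm z)
  rw [(extChartAt (cotModel n) x₀).right_inv hz] at h2
  rw [h2, (extChartAt (𝓡 n) x₀.proj).left_inv]
  rw [extChartAt_cotangent_source] at h1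
  rwa [extChartAt_source]

theorem contMDiff_cotangent_proj :
    ContMDiff (cotModel n) (𝓡 n) ∞ (fun y : Cotangent n N => y.proj) :=
  contMDiff_proj _

/-- The differential of the chart of `T^*N` covers that of the chart of `N`. -/
theorem mfderiv_extChartAt_cotangent_fst {x₀ x : Cotangent n N}
    (hx : x.proj ∈ (chartAt (Eucl n) x₀.proj).source) (v : TangentSpace (cotModel n) x) :
    (mfderiv (cotModel n) 𝓘(ℝ, Eucl n × (Eucl n →L[ℝ] ℝ)) (extChartAt (cotModel n) x₀) x v :
      Eucl n × (Eucl n →L[ℝ] ℝ)).1 =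
      mfderiv (𝓡 n) 𝓘(ℝ, Eucl n) (extChartAt (𝓡 n) x₀.proj) x.proj (dProj x v) := by
  have hx' : x ∈ (chartAt (ModelProd (Eucl n) (Eucl n →L[ℝ] ℝ)) x₀).source := by
    rw [← extChartAt_source (cotModel n), extChartAt_cotangent_source]; exact hx
  have h1 := (ContinuousLinearMap.fst ℝ (Eucl n) (Eucl n →L[ℝ] ℝ)).hasMFDerivAt.comp x
    (mdifferentiableAt_extChartAt (I := cotModel n) hx').hasMFDerivAt
  have h2 := (mdifferentiableAt_extChartAt (I := 𝓡 n) hx).hasMFDerivAt.comp x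
    ((contMDiff_cotangent_proj (n := n)).mdifferentiable (by simp) x).hasMFDerivAt
  have h3 : (ContinuousLinearMap.fst ℝ (Eucl n) (Eucl n →L[ℝ] ℝ)) ∘ extChartAt (cotModel n) x₀ =
      (extChartAt (𝓡 n) x₀.proj) ∘ fun y : Cotangent n N => y.proj :=
    funext fun y => extChartAt_cotangent_apply_fst x₀ y
  rw [h3] at h1
  exact congrArg (fun L : (Eucl n × (Eucl n →L[ℝ] ℝ)) →L[ℝ] Eucl n => L v)
    (hasMFDerivAt_unique h1 h2)

/-- A preferred chart has identity differential at its own centre, so vectors at `x` may be treated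
as pairs (horizontal, vertical). -/
theorem dProj_eq_fst (x : Cotangent n N) (v : TangentSpace (cotModel n) x) :
    (dProj x v : Eucl n) = (v : Eucl n × (Eucl n →L[ℝ] ℝ)).1 := by
  have h := mfderiv_extChartAt_cotangent_fst (mem_chart_source (Eucl n) x.proj) v
  rw [mfderiv_extChartAt_self, mfderiv_extChartAt_self] at h
  exact h.symm

/-- The Liouville form in a chart is `p dq`. -/
theorem liouville_inChart {x₀ : Cotangent n N} {z : Eucl n × (Eucl n →L[ℝ] ℝ)}
    (hz : z ∈ (extChartAt (cotModel n) x₀).target) :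
    (liouville (n := n) (N := N)).toDForm.inChart x₀ z =
      canonicalForm (Eucl n) z := by
  set x := (extChartAt (cotModel n) x₀).symm z with hx
  have hxs : x.proj ∈ (chartAt (Eucl n) x₀.proj).source := by
    have := (extChartAt (cotModel n) x₀).map_target hz
    rwa [extChartAt_cotangent_source] at this
  have hxs' : x ∈ (chartAt (ModelProd (Eucl n) (Eucl n →L[ℝ] ℝ)) x₀).source := by
    rw [← extChartAt_source (cotModel n), extChartAt_cotangent_source]; exact hxs
  have hzx : extChartAt (cotModel n) x₀ x = z := (extChartAt (cotModel n) x₀).right_inv hz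
  have hnhds : (extChartAt (cotModel n) x₀).target ∈ 𝓝 z :=
    (isOpen_extChartAt_target (I := cotModel n) x₀).mem_nhds hz
  have hd : MDifferentiableAt 𝓘(ℝ, Eucl n × (Eucl n →L[ℝ] ℝ)) (cotModel n)
      (extChartAt (cotModel n) x₀).symm z :=
    ((contMDiffOn_extChartAt_symm (n := ∞) x₀).contMDiffAt hnhds).mdifferentiableAt (by simp)
  have hcomp := (mdifferentiableAt_extChartAt (I := cotModel n) hxs').hasMFDerivAt.comp z
    hd.hasMFDerivAt
  have hid : HasMFDerivAt 𝓘(ℝ, Eucl n × (Eucl n →L[ℝ] ℝ)) 𝓘(ℝ, Eucl n × (Eucl n →L[ℝ] ℝ))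
      (extChartAt (cotModel n) x₀ ∘ (extChartAt (cotModel n) x₀).symm) z
      (ContinuousLinearMap.id ℝ (Eucl n × (Eucl n →L[ℝ] ℝ))) := by
    refine (hasMFDerivAt_id z).congr_of_eventuallyEq ?_
    filter_upwards [hnhds] with y hy using (extChartAt (cotModel n) x₀).right_inv hy
  have heq := hasMFDerivAt_unique hcomp hid
  ext v
  have hv : (mfderiv (cotModel n) 𝓘(ℝ, Eucl n × (Eucl n →L[ℝ] ℝ)) (extChartAt (cotModel n) x₀) x
      (mfderiv 𝓘(ℝ, Eucl n × (Eucl n →L[ℝ] ℝ)) (cotModel n) (extChartAt (cotModel n) x₀).symm z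
        (v 0)) : Eucl n × (Eucl n →L[ℝ] ℝ)) = v 0 :=
    congrArg (fun L : (Eucl n × (Eucl n →L[ℝ] ℝ)) →L[ℝ] (Eucl n × (Eucl n →L[ℝ] ℝ)) => L (v 0)) heq
  have h1 := extChartAt_cotangent_apply_snd hxs (dProj x
    (mfderiv 𝓘(ℝ, Eucl n × (Eucl n →L[ℝ] ℝ)) (cotModel n) (extChartAt (cotModel n) x₀).symm z
        (v 0)))
  rw [← mfderiv_extChartAt_cotangent_fst hxs, hv, hzx] at h1
  exact h1.symm

theorem isSmooth_liouville : (liouville (n := n) (N := N)).toDForm.IsSmooth :=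
  fun _ => (contDiff_canonicalForm (Eucl n)).contDiffOn.congr fun _ hz => liouville_inChart hz

/-- The form `dλ₀` in the canonical coordinates `(q, p)`. -/
theorem liouville_d_apply (x : Cotangent n N) (v w : Eucl n × (Eucl n →L[ℝ] ℝ)) :
    ((liouville (n := n) (N := N)).toDForm.d x :
      (Eucl n × (Eucl n →L[ℝ] ℝ)) [⋀^Fin 2]→L[ℝ] ℝ) ![v, w] = v.2 w.1 - w.2 v.1 := by
  have hev : (liouville (n := n) (N := N)).toDForm.inChart x =ᶠ[𝓝 (extChartAt (cotModel n) x x)]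
      canonicalForm (Eucl n) := by
    filter_upwards [(isOpen_extChartAt_target (I := cotModel n) x).mem_nhds
      (mem_extChartAt_target x)] with z hz using liouville_inChart hz
  have h0 : ((liouville (n := n) (N := N)).toDForm.d x :
      (Eucl n × (Eucl n →L[ℝ] ℝ)) [⋀^Fin 2]→L[ℝ] ℝ) ![v, w] =
      extDeriv ((liouville (n := n) (N := N)).toDForm.inChart x) (extChartAt (cotModel n) x x)
        ![v, w] := by
    refine congrArg (extDeriv ((liouville (n := n) (N := N)).toDForm.inChart x)
      (extChartAt (cotModel n) x x)) ?_
    funext j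
    exact congrArg (fun L : (Eucl n × (Eucl n →L[ℝ] ℝ)) →L[ℝ] (Eucl n × (Eucl n →L[ℝ] ℝ)) =>
      L (![v, w] j)) (mfderiv_extChartAt_self (I := cotModel n) (x := x))
  rw [h0, hev.extDeriv_eq, extDeriv_canonicalForm]

end CotangentCharts

/-! ### Curves in an embedded submanifold, and the vanishing of the Liouville form along conormals.
-/

section Immersion

open Set Filter

variable {n d : ℕ}
  {M : Type*} [TopologicalSpace M] [ChartedSpace (Eucl n) M] [IsManifold (𝓡 n) ∞ M]
  {S : Type*} [TopologicalSpace S] [ChartedSpace (Eucl d) S]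

omit [IsManifold (𝓡 n) ∞ M] in
theorem mdifferentiable_of_mem_maximalAtlas {e : OpenPartialHomeomorph M (Eucl n)}
    (he : e ∈ IsManifold.maximalAtlas (𝓡 n) ∞ M) : e.MDifferentiable (𝓡 n) (𝓡 n) := by
  have he' : e ∈ IsManifold.maximalAtlas (𝓡 n) 1 M :=
    IsManifold.maximalAtlas_subset_of_le (by simp) he
  exact ⟨fun x hx => (mdifferentiableAt_of_mem_maximalAtlas he' hx).mdifferentiableWithinAt,
    fun x hx => (mdifferentiableAt_symm_of_mem_maximalAtlas he' hx).mdifferentiableWithinAt⟩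

omit [IsManifold (𝓡 n) ∞ M] in
/-- The velocity of a curve that runs in an embedded submanifold is tangent to it. -/
theorem velocity_mem_range_mfderiv {i : S → M}
    (hi : Manifold.IsSmoothEmbedding (𝓡 d) (𝓡 n) ∞ i) {c : ℝ → M} (hc : ∀ s, c s ∈ range i)
    {s₀ : ℝ} {v : ℝ →L[ℝ] Eucl n} (hv : HasMFDerivAt 𝓘(ℝ, ℝ) (𝓡 n) c s₀ v) {a : S}
    (ha : i a = c s₀) : ∃ w : Eucl d, (mfderiv (𝓡 d) (𝓡 n) i a : Eucl d →L[ℝ] Eucl n) w = v 1 := by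
  have h := hi.isImmersion.isImmersionAt a
  set e := h.codChart
  set e' := h.domChart
  have he := mdifferentiable_of_mem_maximalAtlas h.codChart_mem_maximalAtlas
  have he' := mdifferentiable_of_mem_maximalAtlas h.domChart_mem_maximalAtlas
  have hsub : e'.source ⊆ i ⁻¹' e.source := h.source_subset_preimage_source
  have hae : a ∈ e'.source := h.mem_domChart_source
  have hloc : ∀ b ∈ e'.source, e (i b) = h.equiv (e' b, 0) := by
    intro b hb
    have h1 : e' b ∈ (h.domChart.extend (𝓡 d)).target := by
      simpa [mfld_simps] using e'.map_source hb
    have h2 := h.writtenInCharts h1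
    simpa [mfld_simps, e, e', h.domChart.left_inv hb] using h2
  -- The embedding, not just the immersion, is used here: near `s₀` the curve stays in the single
  -- sheet of `S` parametrized by `e'`.
  obtain ⟨W, hW, hWe⟩ := hi.isEmbedding.isInducing.isOpen_iff.1 e'.open_source
  have haW : c s₀ ∈ W := by
    rw [← ha]
    exact hWe.symm.subset hae
  have hce : c s₀ ∈ e.source := ha ▸ hsub hae
  -- the normal coordinates of the curve vanish
  have hzero : ∀ᶠ s in 𝓝 s₀, (h.equiv.symm (e (c s))).2 = 0 := by
    filter_upwards [hv.continuousAt.preimage_mem_nhds (hW.mem_nhds haW)] with s hs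
    obtain ⟨b, hb⟩ := hc s
    have hbs : b ∈ e'.source := hWe.subset (by rwa [mem_preimage, hb])
    rw [← hb, hloc b hbs]
    simp
  have hec : HasMFDerivAt 𝓘(ℝ, ℝ) (𝓡 n) (e ∘ c) s₀
      ((mfderiv (𝓡 n) (𝓡 n) e (c s₀) : Eucl n →L[ℝ] Eucl n).comp v) :=
    (he.mdifferentiableAt hce).hasMFDerivAt.comp s₀ hv
  have hec' : HasFDerivAt (e ∘ c)
      ((mfderiv (𝓡 n) (𝓡 n) e (c s₀) : Eucl n →L[ℝ] Eucl n).comp v) s₀ :=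
    hasMFDerivAt_iff_hasFDerivAt.1 hec
  have hnormal : (h.equiv.symm (mfderiv (𝓡 n) (𝓡 n) e (c s₀) (v 1))).2 = 0 := by
    have h1 := ((ContinuousLinearMap.snd ℝ (Eucl d) h.complement).hasFDerivAt.comp s₀
      (h.equiv.symm.hasFDerivAt.comp s₀ hec'))
    have h2 := h1.unique ((hasFDerivAt_const (0 : h.complement) s₀).congr_of_eventuallyEq hzero)
    exact congrArg (fun L : ℝ →L[ℝ] h.complement => L 1) h2
  obtain ⟨w, hw⟩ := he'.mfderiv_surjective hae
    (h.equiv.symm (mfderiv (𝓡 n) (𝓡 n) e (c s₀) (v 1))).1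
  refine ⟨w, he.mfderiv_injective hce ?_⟩
  have hi' : MDifferentiableAt (𝓡 d) (𝓡 n) i a :=
    (hi.isImmersion.contMDiff a).mdifferentiableAt (by simp)
  have hce' : i a ∈ e.source := hsub hae
  have h1 := (he.mdifferentiableAt hce').hasMFDerivAt.comp a hi'.hasMFDerivAt
  have h2 : HasMFDerivAt (𝓡 d) (𝓡 n) (e ∘ i) a
      (((h.equiv : (Eucl d × h.complement) →L[ℝ] Eucl n).comp
        (ContinuousLinearMap.inl ℝ (Eucl d) h.complement)).comp
        (mfderiv (𝓡 d) (𝓡 d) e' a : Eucl d →L[ℝ] Eucl d)) := by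
    refine HasMFDerivAt.congr_of_eventuallyEq
      (((h.equiv : (Eucl d × h.complement) →L[ℝ] Eucl n).comp
        (ContinuousLinearMap.inl ℝ (Eucl d) h.complement)).hasMFDerivAt.comp a
        (he'.mdifferentiableAt hae).hasMFDerivAt) ?_
    filter_upwards [e'.open_source.mem_nhds hae] with b hb using hloc b hb
  have h3 : (mfderiv (𝓡 n) (𝓡 n) e (i a) : Eucl n →L[ℝ] Eucl n)
      ((mfderiv (𝓡 d) (𝓡 n) i a : Eucl d →L[ℝ] Eucl n) w) =
      h.equiv ((mfderiv (𝓡 d) (𝓡 d) e' a : Eucl d →L[ℝ] Eucl d) w, 0) :=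
    congrArg (fun L : Eucl d →L[ℝ] Eucl n => L w) (hasMFDerivAt_unique h1 h2)
  rw [← ha] at hnormal hw ⊢
  refine h3.trans ?_
  refine h.equiv.symm.injective ?_
  rw [ContinuousLinearEquiv.symm_apply_apply]
  exact Prod.ext hw hnormal.symm

/-- The hypothesis ranges over all preimages `a` of the footpoint because the one witnessing
membership in `N^*S` is existentially bound. -/
theorem liouville_apply_eq_zero_of_mem_conormal {i : S → M} {x : Cotangent n M}
    (hx : x ∈ conormal (d := d) i) {v : TangentSpace (cotModel n) x}
    (hv : ∀ a, i a = x.proj →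
      ∃ w : Eucl d, (mfderiv (𝓡 d) (𝓡 n) i a : Eucl d →L[ℝ] Eucl n) w = (dProj x v : Eucl n)) :
    liouville x v = 0 := by
  obtain ⟨a, ξ, rfl, h⟩ := hx
  obtain ⟨w, hw⟩ := hv a rfl
  exact (congrArg ξ hw).symm.trans (h w)

end Immersion

/-! ### Cylinders as periodic maps of the strip. -/

section Cylinder

open Set

variable {E : Type*} [NormedAddCommGroup E] [NormedSpace ℝ E]
  {H : Type*} [TopologicalSpace H] {I : ModelWithCorners ℝ E H}
  {N : Type*} [TopologicalSpace N] [ChartedSpace H N]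

omit [TopologicalSpace N] in
theorem cylinderParam_add_one (f : Circle × unitInterval → N) (s t : ℝ) :
    cylinderParam f (s + 1, t) = cylinderParam f (s, t) := by
  simp only [cylinderParam, mul_add, mul_one, Circle.exp_add, Circle.exp_two_pi]

/-- Outside the strip the clamping of `t` is only continuous, which is why all derivatives are taken
within `strip`. -/
theorem contMDiffOn_cylinderParam {f : Circle × unitInterval → N} (hf : IsSmoothCylinder I f) :
    ContMDiffOn 𝓘(ℝ, ℝ × ℝ) I ∞ (cylinderParam f) strip := by
  refine ContMDiff.comp_contMDiffOn (I' := (𝓡 1).prod (𝓡∂ 1)) (g := f)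
    (f := fun z : ℝ × ℝ => (Circle.exp (2 * Real.pi * z.1), projIcc 0 1 zero_le_one z.2)) hf ?_
  refine ContMDiffOn.prodMk ?_ ?_
  · have h : ContMDiff 𝓘(ℝ, ℝ × ℝ) 𝓘(ℝ, ℝ) ∞ (fun z : ℝ × ℝ => 2 * Real.pi * z.1) :=
      (contDiff_const.mul contDiff_fst).contMDiff
    exact (contMDiff_circleExp.comp h).contMDiffOn
  · have h : ContMDiff 𝓘(ℝ, ℝ × ℝ) 𝓘(ℝ, ℝ) ∞ (fun z : ℝ × ℝ => z.2) := contDiff_snd.contMDiff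
    exact (contMDiffOn_projIcc (x := (0 : ℝ)) (y := 1)).comp h.contMDiffOn fun z hz => hz.2

theorem cylinderIntegral_eq (η : DForm I N 2) (f : Circle × unitInterval → N) :
    cylinderIntegral η f = ∫ s in (0 : ℝ)..1, ∫ t in (0 : ℝ)..1,
      pullbackWithin η (cylinderParam f) strip (s, t) ![(1, 0), (0, 1)] := by
  refine intervalIntegral.integral_congr fun s _ => intervalIntegral.integral_congr fun t _ => ?_
  refine DForm.apply_congr η rfl ?_
  funext j
  fin_cases j <;> rfl

theorem mapsTo_add_strip (c : ℝ) : MapsTo (fun z : ℝ × ℝ => z + (c, 0)) strip strip :=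
  fun z hz => ⟨mem_univ _, by simpa using hz.2⟩

theorem mfderivWithin_comp_add_strip {F : ℝ × ℝ → N} (hF : ContMDiffOn 𝓘(ℝ, ℝ × ℝ) I ∞ F strip)
    (c : ℝ) {z : ℝ × ℝ} (hz : z ∈ strip) :
    (mfderivWithin 𝓘(ℝ, ℝ × ℝ) I (fun y => F (y + (c, 0))) strip z : ℝ × ℝ →L[ℝ] E) =
      (mfderivWithin 𝓘(ℝ, ℝ × ℝ) I F strip (z + (c, 0)) : ℝ × ℝ →L[ℝ] E) := by
  have h1 := ((hF _ (mapsTo_add_strip c hz)).mdifferentiableWithinAt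
    (by simp)).hasMFDerivWithinAt
  have h2 : HasMFDerivWithinAt 𝓘(ℝ, ℝ × ℝ) 𝓘(ℝ, ℝ × ℝ) (fun y : ℝ × ℝ => y + (c, 0)) strip z
      (ContinuousLinearMap.id ℝ (ℝ × ℝ)) :=
    ((hasFDerivWithinAt_id z strip).add_const (c, 0)).hasMFDerivWithinAt
  exact (h1.comp z h2 (mapsTo_add_strip c)).mfderivWithin
    (uniqueDiffOn_strip z hz).uniqueMDiffWithinAt

theorem pullbackWithin_comp_add_strip {k : ℕ} (η : DForm I N k) {F : ℝ × ℝ → N}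
    (hF : ContMDiffOn 𝓘(ℝ, ℝ × ℝ) I ∞ F strip) (c : ℝ) {z : ℝ × ℝ} (hz : z ∈ strip) :
    pullbackWithin η (fun y => F (y + (c, 0))) strip z =
      pullbackWithin η F strip (z + (c, 0)) := by
  ext v
  refine DForm.apply_congr η rfl ?_
  funext j
  exact congrArg (fun L : ℝ × ℝ →L[ℝ] E => L (v j)) (mfderivWithin_comp_add_strip hF c hz)

theorem pullbackCovector_comp_add_strip (θ : OneForm I N) {F : ℝ × ℝ → N}
    (hF : ContMDiffOn 𝓘(ℝ, ℝ × ℝ) I ∞ F strip) (c : ℝ) {z : ℝ × ℝ} (hz : z ∈ strip) :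
    pullbackCovector θ (fun y => F (y + (c, 0))) strip z =
      pullbackCovector θ F strip (z + (c, 0)) :=
  congrArg (fun L : ℝ × ℝ →L[ℝ] E => (θ (F (z + (c, 0))) : E →L[ℝ] ℝ).comp L)
    (mfderivWithin_comp_add_strip hF c hz)

/-- Restricted to a boundary line, the derivative of a map on the strip is that of the
restriction. -/
theorem hasMFDerivAt_horizontal {F : ℝ × ℝ → N} (hF : ContMDiffOn 𝓘(ℝ, ℝ × ℝ) I ∞ F strip)
    {s t : ℝ} (ht : t ∈ Icc (0 : ℝ) 1) :
    HasMFDerivAt 𝓘(ℝ, ℝ) I (fun s => F (s, t)) s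
      ((mfderivWithin 𝓘(ℝ, ℝ × ℝ) I F strip (s, t) : ℝ × ℝ →L[ℝ] E).comp
        (ContinuousLinearMap.inl ℝ ℝ ℝ)) := by
  have h1 := ((hF (s, t) ⟨mem_univ _, ht⟩).mdifferentiableWithinAt
    (by simp)).hasMFDerivWithinAt
  have h2 : HasMFDerivWithinAt 𝓘(ℝ, ℝ) 𝓘(ℝ, ℝ × ℝ) (fun s : ℝ => (s, t)) univ s
      (ContinuousLinearMap.inl ℝ ℝ ℝ) :=
    (hasFDerivAt_prodMk_left s t).hasFDerivWithinAt.hasMFDerivWithinAt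
  have h3 : univ ⊆ (fun s : ℝ => (s, t)) ⁻¹' strip := fun y _ => ⟨mem_univ _, ht⟩
  exact hasMFDerivWithinAt_univ.1 (HasMFDerivWithinAt.comp s h1 h2 h3)

end Cylinder

/-! ### Vanishing of the `dλ₀` part of the area. -/

section LiouvilleIntegral

open Set

variable {n d : ℕ}
  {M : Type*} [TopologicalSpace M] [ChartedSpace (Eucl n) M] [IsManifold (𝓡 n) ∞ M]
  {S : Type*} [TopologicalSpace S] [ChartedSpace (Eucl d) S]

theorem pullbackCovector_liouville_eq_zero {i : S → M}
    (hi : Manifold.IsSmoothEmbedding (𝓡 d) (𝓡 n) ∞ i) {F : ℝ × ℝ → Cotangent n M}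
    (hF : ContMDiffOn 𝓘(ℝ, ℝ × ℝ) (cotModel n) ∞ F strip) {t : ℝ} (ht : t ∈ Icc (0 : ℝ) 1)
    (hFt : ∀ s, F (s, t) ∈ conormal (d := d) i) (s : ℝ) :
    pullbackCovector liouville F strip (s, t) (1, 0) = 0 := by
  refine liouville_apply_eq_zero_of_mem_conormal (hFt s) fun a ha => ?_
  have h := ((contMDiff_cotangent_proj (n := n) (N := M)).mdifferentiable (by simp)
    (F (s, t))).hasMFDerivAt.comp s (hasMFDerivAt_horizontal hF (s := s) ht)
  refine velocity_mem_range_mfderiv hi (c := fun s => (F (s, t)).proj) (fun s => ?_) h ha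
  obtain ⟨b, ξ, hb, -⟩ := hFt s
  exact ⟨b, by rw [hb]⟩

theorem integral_d_liouville_eq_zero {i : S → M}
    (hi : Manifold.IsSmoothEmbedding (𝓡 d) (𝓡 n) ∞ i) {f : Circle × unitInterval → Cotangent n M}
    (hf : IsSmoothCylinder (cotModel n) f)
    (hbd : ∀ z, f (z, 0) ∈ conormal (d := d) i ∧ f (z, 1) ∈ conormal (d := d) i) :
    ∫ s in (0 : ℝ)..1, ∫ t in (0 : ℝ)..1, pullbackWithin (liouville (n := n) (N := M)).toDForm.d
      (cylinderParam f) strip (s, t) ![(1, 0), (0, 1)] = 0 := by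
  have hF := contMDiffOn_cylinderParam hf
  have h0 := pullbackCovector_liouville_eq_zero hi hF (left_mem_Icc.2 zero_le_one) fun s => by
    simpa [cylinderParam] using (hbd (Circle.exp (2 * Real.pi * s))).1
  have h1 := pullbackCovector_liouville_eq_zero hi hF (right_mem_Icc.2 zero_le_one) fun s => by
    simpa [cylinderParam] using (hbd (Circle.exp (2 * Real.pi * s))).2
  rw [integral_pullbackWithin_d isSmooth_liouville hF]
  have hper : ∫ t in (0 : ℝ)..1, pullbackCovector liouville (cylinderParam f) strip (1, t) (0, 1) =
      ∫ t in (0 : ℝ)..1, pullbackCovector liouville (cylinderParam f) strip (0, t) (0, 1) := by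
    refine intervalIntegral.integral_congr fun t ht => ?_
    rw [uIcc_of_le (zero_le_one' ℝ)] at ht
    have h := pullbackCovector_comp_add_strip liouville hF 1 (z := (0, t)) ⟨mem_univ _, ht⟩
    have e : (fun y : ℝ × ℝ => cylinderParam f (y + (1, 0))) = cylinderParam f := by
      funext y
      have := cylinderParam_add_one f y.1 y.2
      rwa [show y + (1, 0) = (y.1 + 1, y.2) by ext <;> simp]
    rw [e] at h
    simp only [h]
    simp
  rw [hper]
  simp [h0, h1]

end LiouvilleIntegral

/-! ### Lifting to the universal cover, and the `k`-fold cover argument for the `σ` part. -/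

section Covering

open Set Filter

/-- `IsCoveringMap` allows empty fibres. Over an evenly covered set either all fibres are empty or
none is, so the range is clopen. -/
theorem surjective_of_isCoveringMap {X Y : Type*} [TopologicalSpace X] [TopologicalSpace Y]
    [Nonempty X] [PreconnectedSpace Y] {p : X → Y} (hp : IsCoveringMap p) :
    Function.Surjective p := by
  have hclosed : IsClosed (range p) := by
    refine isOpen_compl_iff.1 (isOpen_iff_mem_nhds.2 fun y hy => ?_)
    obtain ⟨-, V, hyV, hV, -, e, he⟩ := hp y
    filter_upwards [hV.mem_nhds hyV] with z hz
    rintro ⟨x, rfl⟩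
    refine hy ⟨(e.symm (⟨y, hyV⟩, (e ⟨x, hz⟩).2) : p ⁻¹' V), ?_⟩
    rw [← he, Homeomorph.apply_symm_apply]
  exact range_eq_univ.1 (IsClopen.eq_univ ⟨hclosed, hp.isOpenMap.isOpen_range⟩ (range_nonempty p))

variable {n : ℕ}
  {M : Type*} [TopologicalSpace M] [ChartedSpace (Eucl n) M] [IsManifold (𝓡 n) ∞ M]
  {U : Type*} [TopologicalSpace U] [ChartedSpace (Eucl n) U] [IsManifold (𝓡 n) ∞ U]

/-- The differential at `q` of the preferred chart at `q₀`. -/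
def chartDeriv {E H N : Type*} [NormedAddCommGroup E] [NormedSpace ℝ E] [TopologicalSpace H]
    (I : ModelWithCorners ℝ E H) [TopologicalSpace N] [ChartedSpace H N] (q₀ q : N) : E →L[ℝ] E :=
  mfderiv I 𝓘(ℝ, E) (extChartAt I q₀) q

/-- A `1`-form on `U` is bounded with respect to the lift of a metric under `p : U → M`, locally
uniformly on `M`. -/
def IsLocallyBoundedOver (p : U → M) (θ : OneForm (𝓡 n) U) : Prop :=
  ∀ q₀ : M, ∃ V ∈ 𝓝 q₀, ∃ C : ℝ, ∀ x : U, p x ∈ V → ∀ v : Eucl n,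
    |(θ x : Eucl n →L[ℝ] ℝ) v| ≤
      C * ‖chartDeriv (𝓡 n) q₀ (p x) ((mfderiv (𝓡 n) (𝓡 n) p x : Eucl n →L[ℝ] Eucl n) v)‖

omit [IsManifold (𝓡 n) ∞ M] [IsManifold (𝓡 n) ∞ U] in
-- By continuity, `F` agrees near each point with a local inverse of `p` composed with `u`.
theorem contMDiffOn_lift {p : U → M} (hp : IsLocalDiffeomorph (𝓡 n) (𝓡 n) ∞ p)
    {F : ℝ × ℝ → U} (hF : Continuous F) {u : ℝ × ℝ → M} (hu : p ∘ F = u) {A : Set (ℝ × ℝ)}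
    (huA : ContMDiffOn 𝓘(ℝ, ℝ × ℝ) (𝓡 n) ∞ u A) : ContMDiffOn 𝓘(ℝ, ℝ × ℝ) (𝓡 n) ∞ F A := by
  subst hu
  intro z hz
  have h := hp (F z)
  have hev : ∀ᶠ w in 𝓝[A] z, F w = (h.localInverse ∘ (p ∘ F)) w := by
    filter_upwards [nhdsWithin_le_nhds (hF.continuousAt.preimage_mem_nhds
      (h.localInverse.open_target.mem_nhds h.localInverse_mem_target))] with w hw
    exact (h.localInverse_left_inv hw).symm
  exact (ContMDiffAt.comp_contMDiffWithinAt z (g := h.localInverse) h.localInverse_contMDiffAt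
    (huA z hz)).congr_of_eventuallyEq hev (hev.self_of_nhdsWithin hz)

omit [IsManifold (𝓡 n) ∞ U] in
/-- Boundedness along all lifts of a strip. -/
theorem IsLocallyBoundedOver.exists_bound {p : U → M}
    (hp : IsLocalDiffeomorph (𝓡 n) (𝓡 n) ∞ p) {θ : OneForm (𝓡 n) U}
    (hθ : IsLocallyBoundedOver p θ) {u : ℝ × ℝ → M}
    (hu : ContMDiffOn 𝓘(ℝ, ℝ × ℝ) (𝓡 n) ∞ u strip) :
    ∃ B : ℝ, ∀ t ∈ Icc (0 : ℝ) 1, ∀ F : ℝ × ℝ → U, Continuous F → p ∘ F = u →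
      |pullbackCovector θ F strip (0, t) (0, 1)| ≤ B := by
  -- Compactness of `[0,1]` leaves only a local bound near each `t₀` to be shown.
  refine isCompact_Icc.induction_on (p := fun s : Set ℝ => ∃ B : ℝ, ∀ t ∈ s,
    ∀ F : ℝ × ℝ → U, Continuous F → p ∘ F = u →
      |pullbackCovector θ F strip (0, t) (0, 1)| ≤ B) ⟨0, by simp⟩ ?_ ?_ ?_
  · rintro s t hst ⟨B, hB⟩
    exact ⟨B, fun x hx => hB x (hst hx)⟩
  · rintro s t ⟨B, hB⟩ ⟨B', hB'⟩
    refine ⟨max B B', fun x hx F hF hFu => ?_⟩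
    rcases hx with hx | hx
    · exact (hB x hx F hF hFu).trans (le_max_left _ _)
    · exact (hB' x hx F hF hFu).trans (le_max_right _ _)
  intro t₀ ht₀
  obtain ⟨V, hV, C, hC⟩ := hθ (u (0, t₀))
  set q₀ := u (0, t₀) with hq₀
  have hz₀ : ((0 : ℝ), t₀) ∈ strip := ⟨mem_univ _, ht₀⟩
  have hsub : ContinuousWithinAt (fun t : ℝ => ((0 : ℝ), t)) (Icc 0 1) t₀ := by fun_prop
  have hmaps : MapsTo (fun t : ℝ => ((0 : ℝ), t)) (Icc 0 1) strip := fun t ht => ⟨mem_univ _, ht⟩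
  have hcont : ContinuousWithinAt (fun t : ℝ => u (0, t)) (Icc 0 1) t₀ :=
    (hu (0, t₀) hz₀).continuousWithinAt.comp hsub hmaps
  have hφ : ContDiffWithinAt ℝ ∞ (extChartAt (𝓡 n) q₀ ∘ u) strip (0, t₀) :=
    ((contMDiffAt_extChartAt' (mem_chart_source _ q₀)).comp_contMDiffWithinAt _
      (hu _ hz₀)).contDiffWithinAt
  have hderiv : ContinuousWithinAt (fun t : ℝ =>
      ‖fderivWithin ℝ (extChartAt (𝓡 n) q₀ ∘ u) strip (0, t) (0, 1)‖) (Icc 0 1) t₀ := by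
    have h1 := (hφ.fderivWithin_right (m := ∞) uniqueDiffOn_strip (by simp)
      hz₀).continuousWithinAt
    exact ((h1.comp hsub hmaps).clm_apply continuousWithinAt_const).norm
  have hbd := hderiv.eventually_lt_const (lt_add_one _)
  refine ⟨{t | t ∈ Icc (0 : ℝ) 1 ∧ u (0, t) ∈ V ∧ u (0, t) ∈ (chartAt (Eucl n) q₀).source ∧
    ‖fderivWithin ℝ (extChartAt (𝓡 n) q₀ ∘ u) strip (0, t) (0, 1)‖ <
      ‖fderivWithin ℝ (extChartAt (𝓡 n) q₀ ∘ u) strip (0, t₀) (0, 1)‖ + 1}, ?_,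
    |C| * (‖fderivWithin ℝ (extChartAt (𝓡 n) q₀ ∘ u) strip (0, t₀) (0, 1)‖ + 1), ?_⟩
  · filter_upwards [self_mem_nhdsWithin, hcont.preimage_mem_nhdsWithin hV,
      hcont.preimage_mem_nhdsWithin ((chartAt (Eucl n) q₀).open_source.mem_nhds
        (mem_chart_source _ q₀)), hbd] with t h1 h2 h3 h4 using ⟨h1, h2, h3, h4⟩
  · rintro t ⟨ht, htV, hts, htb⟩ F hF rfl
    have hz : ((0 : ℝ), t) ∈ strip := ⟨mem_univ _, ht⟩
    have hFs := contMDiffOn_lift hp hF rfl hu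
    have hF1 := ((hFs _ hz).mdifferentiableWithinAt (by simp)).hasMFDerivWithinAt
    have hp1 := (hp.mdifferentiable (by simp) (F (0, t))).hasMFDerivAt
    have he1 := (mdifferentiableAt_extChartAt (I := 𝓡 n) hts).hasMFDerivAt
    let D : ℝ × ℝ →L[ℝ] Eucl n := mfderivWithin 𝓘(ℝ, ℝ × ℝ) (𝓡 n) F strip (0, t)
    let D' : Eucl n →L[ℝ] Eucl n := mfderiv (𝓡 n) (𝓡 n) p (F (0, t))
    -- The vector measured by the bound on `θ` is the velocity of `p ∘ F` in a chart of `M`; it does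
    -- not see the choice of the lift, so one constant serves all lifts.
    have h1 : HasFDerivWithinAt (extChartAt (𝓡 n) q₀ ∘ (p ∘ F))
        ((chartDeriv (𝓡 n) q₀ (p (F (0, t)))).comp (D'.comp D)) strip (0, t) :=
      hasMFDerivWithinAt_iff_hasFDerivWithinAt.1
        (he1.comp_hasMFDerivWithinAt _ (hp1.comp_hasMFDerivWithinAt _ hF1))
    have h' := h1.fderivWithin (uniqueDiffOn_strip _ hz)
    refine (hC (F (0, t)) htV _).trans ?_
    have h2 := congrArg (fun L : ℝ × ℝ →L[ℝ] Eucl n => ‖L (0, 1)‖) h'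
    refine mul_le_mul (le_abs_self C) (le_of_eq_of_le h2.symm htb.le) (norm_nonneg _)
      (abs_nonneg C)

theorem pullbackWithin_pullback {E H N E' H' N' : Type*} [NormedAddCommGroup E] [NormedSpace ℝ E]
    [TopologicalSpace H] {I : ModelWithCorners ℝ E H} [TopologicalSpace N] [ChartedSpace H N]
    [NormedAddCommGroup E'] [NormedSpace ℝ E'] [TopologicalSpace H'] {I' : ModelWithCorners ℝ E' H'}
    [TopologicalSpace N'] [ChartedSpace H' N'] {p : N → N'} (hp : MDifferentiable I I' p) {k : ℕ}
    (η : DForm I' N' k) {F : ℝ × ℝ → N} {A : Set (ℝ × ℝ)} {z : ℝ × ℝ}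
    (hF : MDifferentiableWithinAt 𝓘(ℝ, ℝ × ℝ) I F A z) (hA : UniqueDiffWithinAt ℝ A z) :
    pullbackWithin (DForm.pullback I p η) F A z = pullbackWithin η (p ∘ F) A z := by
  ext v
  refine DForm.apply_congr η rfl ?_
  funext j
  have h := mfderiv_comp_mfderivWithin (I := 𝓘(ℝ, ℝ × ℝ)) (I' := I) (I'' := I') z (hp (F z)) hF
    hA.uniqueMDiffWithinAt
  exact congrArg (fun L : ℝ × ℝ →L[ℝ] E' => L (v j)) h.symm

/-- The plane is simply connected; surjectivity supplies a starting point for the lift. -/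
theorem exists_lift {p : U → M} (hp : IsCoveringMap p) (hps : Function.Surjective p)
    {u : ℝ × ℝ → M} (hu : Continuous u) : ∃ F : ℝ × ℝ → U, Continuous F ∧ p ∘ F = u := by
  obtain ⟨e, he⟩ := hps (u 0)
  obtain ⟨F, hF, -⟩ := hp.existsUnique_continuousMap_lifts ⟨u, hu⟩ 0 e he
  exact ⟨F, F.continuous, hF.2⟩

/-- If `θ` restricts to the differential of a bounded function on the preimage of `R`, then its
integrals along horizontal boundary lines that lie over `R` are bounded. -/
theorem abs_integral_horizontal_le {θ : OneForm (𝓡 n) U} (hθ : θ.toDForm.IsSmooth) {R : Set U}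
    {b : U → ℝ} {C : ℝ} (hb : ∀ x ∈ R, |b x| ≤ C)
    (hd : ∀ x ∈ R, HasMFDerivWithinAt (𝓡 n) 𝓘(ℝ, ℝ) b R x (θ x)) {F : ℝ × ℝ → U}
    (hF : ContMDiffOn 𝓘(ℝ, ℝ × ℝ) (𝓡 n) ∞ F strip) {t : ℝ} (ht : t ∈ Icc (0 : ℝ) 1)
    (hR : ∀ s, F (s, t) ∈ R) (a c : ℝ) :
    |∫ s in a..c, pullbackCovector θ F strip (s, t) (1, 0)| ≤ 2 * C := by
  have hder (s : ℝ) : HasDerivAt (fun s => b (F (s, t)))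
      (pullbackCovector θ F strip (s, t) (1, 0)) s := by
    have h1 := (hasMFDerivAt_horizontal hF (s := s) ht).hasMFDerivWithinAt (s := univ)
    have h3 : univ ⊆ (fun s : ℝ => F (s, t)) ⁻¹' R := fun s _ => hR s
    have h2 := hasMFDerivWithinAt_univ.1 (HasMFDerivWithinAt.comp s (hd _ (hR s)) h1 h3)
    have h4 : HasFDerivAt (fun s => b (F (s, t)))
        ((pullbackCovector θ F strip (s, t)).comp (ContinuousLinearMap.inl ℝ ℝ ℝ)) s :=
      hasMFDerivAt_iff_hasFDerivAt.1 h2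
    exact h4.hasDerivAt
  have hcont : Continuous fun s => pullbackCovector θ F strip (s, t) (1, 0) := by
    have := (continuousOn_pullbackCovector_apply hθ hF (1, 0)).comp_continuous
      (f := fun s : ℝ => (s, t)) (by fun_prop) (fun s => ⟨mem_univ _, ht⟩)
    exact this
  rw [intervalIntegral.integral_eq_sub_of_hasDerivAt (fun s _ => hder s)
    (hcont.intervalIntegrable _ _)]
  have h1 := abs_le.1 (hb _ (hR c))
  have h2 := abs_le.1 (hb _ (hR a))
  rw [abs_le]
  constructor <;> linarith [h1.1, h1.2, h2.1, h2.2]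

theorem intervalIntegrable_integral_strip {g : ℝ × ℝ → ℝ} (hg : ContinuousOn g strip) (a b : ℝ) :
    IntervalIntegrable (fun s => ∫ t in (0 : ℝ)..1, g (s, t)) MeasureTheory.volume a b := by
  -- Clamping `t` extends `g` continuously to the plane without changing the integrals over `[0,1]`.
  have hG : Continuous fun z : ℝ × ℝ => g (z.1, projIcc (0 : ℝ) 1 zero_le_one z.2) :=
    hg.comp_continuous (by fun_prop) fun z => ⟨mem_univ _, (projIcc (0 : ℝ) 1 zero_le_one z.2).2⟩
  have e : (fun s => ∫ t in (0 : ℝ)..1, g (s, t)) =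
      fun s => ∫ t in (0 : ℝ)..1, g (s, projIcc (0 : ℝ) 1 zero_le_one t) := by
    funext s
    refine intervalIntegral.integral_congr fun t ht => ?_
    rw [uIcc_of_le (zero_le_one' ℝ)] at ht
    simp only [projIcc_of_mem zero_le_one ht]
  rw [e]
  exact (intervalIntegral.continuous_parametric_intervalIntegral_of_continuous'
    (f := fun s t => g (s, projIcc (0 : ℝ) 1 zero_le_one t)) hG 0 1).intervalIntegrable _ _

/-- The area of a cylinder `u` with boundary in `R₀` vanishes, because that of its `k`-fold
covers is bounded independently of `k`. -/
theorem integral_pullbackWithin_eq_zero {p : U → M} (hp : IsCoveringMap p)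
    (hpl : IsLocalDiffeomorph (𝓡 n) (𝓡 n) ∞ p) (hps : Function.Surjective p)
    {σ : DForm (𝓡 n) M 2} {θ : OneForm (𝓡 n) U}
    (hθ : IsPrimitive θ (DForm.pullback (𝓡 n) p σ)) (hbd : IsLocallyBoundedOver p θ)
    {R : Set M} {b : U → ℝ} {C : ℝ} (hb : ∀ x ∈ p ⁻¹' R, |b x| ≤ C)
    (hd : ∀ x ∈ p ⁻¹' R, HasMFDerivWithinAt (𝓡 n) 𝓘(ℝ, ℝ) b (p ⁻¹' R) x (θ x))
    {u : ℝ × ℝ → M} (huc : Continuous u) (hu : ContMDiffOn 𝓘(ℝ, ℝ × ℝ) (𝓡 n) ∞ u strip)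
    (hper : ∀ z, u (z + (1, 0)) = u z) (hu0 : ∀ s, u (s, 0) ∈ R) (hu1 : ∀ s, u (s, 1) ∈ R) :
    ContinuousOn (fun z => pullbackWithin σ u strip z ![(1, 0), (0, 1)]) strip ∧
    ∫ s in (0 : ℝ)..1, ∫ t in (0 : ℝ)..1, pullbackWithin σ u strip (s, t) ![(1, 0), (0, 1)] = 0 := by
  obtain ⟨F, hFc, hFu⟩ := exists_lift hp hps huc
  have hF := contMDiffOn_lift hpl hFc hFu hu
  have hpt : ∀ z ∈ strip, pullbackWithin σ u strip z ![(1, 0), (0, 1)] =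
      pullbackWithin θ.toDForm.d F strip z ![(1, 0), (0, 1)] := by
    intro z hz
    rw [hθ.2, pullbackWithin_pullback (hpl.mdifferentiable (by simp)) σ
      ((hF z hz).mdifferentiableWithinAt (by simp)) (uniqueDiffOn_strip z hz), hFu]
  have hcont : ContinuousOn (fun z => pullbackWithin σ u strip z ![(1, 0), (0, 1)]) strip :=
    (continuousOn_pullbackWithin_d hθ.1 hF _ _).congr hpt
  refine ⟨hcont, ?_⟩
  obtain ⟨B, hB⟩ := hbd.exists_bound hpl hu
  have hper' (k : ℕ) : ∀ z, u (z + ((k : ℝ), 0)) = u z := by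
    induction k with
    | zero => intro z; rw [Nat.cast_zero, show ((0 : ℝ), (0 : ℝ)) = 0 from rfl, add_zero]
    | succ k ih =>
      intro z
      rw [← ih z, ← hper (z + ((k : ℝ), 0))]
      congr 1
      ext <;> simp [add_assoc]
  -- By periodicity of `u`, the translate of `F` by `(k, 0)` is again a lift of `u`, so the bound
  -- along all lifts at `s = 0` applies to it.
  have hvert (k : ℕ) (t : ℝ) (ht : t ∈ Icc (0 : ℝ) 1) :
      |pullbackCovector θ F strip ((k : ℝ), t) (0, 1)| ≤ B := by
    have h1 := hB t ht (fun z => F (z + ((k : ℝ), 0))) (by fun_prop) (by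
      funext z
      exact (congrFun hFu _).trans (hper' k z))
    rw [pullbackCovector_comp_add_strip θ hF k (z := (0, t)) ⟨mem_univ _, ht⟩] at h1
    simpa using h1
  have hvertI (k : ℕ) : |∫ t in (0 : ℝ)..1, pullbackCovector θ F strip ((k : ℝ), t) (0, 1)| ≤ B := by
    have h := intervalIntegral.norm_integral_le_of_norm_le_const (a := (0 : ℝ)) (b := 1) (C := B)
      (f := fun t => pullbackCovector θ F strip ((k : ℝ), t) (0, 1)) fun t ht => by
        rw [uIoc_of_le zero_le_one] at ht
        exact hvert k t (Ioc_subset_Icc_self ht)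
    simpa using h
  set G : ℝ → ℝ := fun s => ∫ t in (0 : ℝ)..1, pullbackWithin σ u strip (s, t) ![(1, 0), (0, 1)]
    with hG
  have hGper : Function.Periodic G 1 := by
    intro s
    refine intervalIntegral.integral_congr fun t ht => ?_
    rw [uIcc_of_le (zero_le_one' ℝ)] at ht
    have h := pullbackWithin_comp_add_strip σ hu 1 (z := (s, t)) ⟨mem_univ _, ht⟩
    rw [show (fun y => u (y + (1, 0))) = u from funext hper] at h
    simp only [h]
    simp
  have hk (k : ℕ) : (k : ℝ) * ∫ s in (0 : ℝ)..1, G s = ∫ s in (0 : ℝ)..k, G s := by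
    have h := hGper.intervalIntegral_add_zsmul_eq k 0 (intervalIntegrable_integral_strip hcont)
    simpa using h.symm
  -- Each of the two horizontal sides contributes at most `2C` (the endpoint values of `b`), each
  -- vertical side at most `B`.
  have hbound (k : ℕ) : (k : ℝ) * |∫ s in (0 : ℝ)..1, G s| ≤ 4 * C + 2 * B := by
    have e : ∫ s in (0 : ℝ)..k, G s = ∫ s in (0 : ℝ)..k, ∫ t in (0 : ℝ)..1,
        pullbackWithin θ.toDForm.d F strip (s, t) ![(1, 0), (0, 1)] := by
      refine intervalIntegral.integral_congr fun s _ => intervalIntegral.integral_congr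
        fun t ht => hpt _ ⟨mem_univ _, ?_⟩
      rwa [uIcc_of_le (zero_le_one' ℝ)] at ht
    rw [← Nat.abs_cast k, ← abs_mul, hk, e, integral_pullbackWithin_d hθ.1 hF]
    have h0 := abs_le.1 (abs_integral_horizontal_le hθ.1 hb hd hF (left_mem_Icc.2 zero_le_one)
      (fun s => by rw [mem_preimage, ← Function.comp_apply (f := p), hFu]; exact hu0 s) 0 k)
    have h1 := abs_le.1 (abs_integral_horizontal_le hθ.1 hb hd hF (right_mem_Icc.2 zero_le_one)
      (fun s => by rw [mem_preimage, ← Function.comp_apply (f := p), hFu]; exact hu1 s) 0 k)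
    have h2 := abs_le.1 (hvertI k)
    have h3 := abs_le.1 (hvertI 0)
    simp only [Nat.cast_zero] at h3
    simp only [intervalIntegral.integral_neg]
    rw [abs_le]
    constructor <;> linarith [h0.1, h0.2, h1.1, h1.2, h2.1, h2.2, h3.1, h3.2]
  by_contra hne
  obtain ⟨k, hk⟩ := exists_nat_gt ((4 * C + 2 * B) / |∫ s in (0 : ℝ)..1, G s|)
  rw [div_lt_iff₀ (abs_pos.2 hne)] at hk
  exact absurd (hbound k) (not_le.2 hk)

end Covering

/-! ### Local comparison of a Riemannian metric with the norm of a chart. -/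

section Metric

open Bundle Filter

variable {E : Type*} [NormedAddCommGroup E] [NormedSpace ℝ E]
  {H : Type*} [TopologicalSpace H] {I : ModelWithCorners ℝ E H}
  {N : Type*} [TopologicalSpace N] [ChartedSpace H N] [IsManifold I 1 N]

/-- The norm of a Riemannian metric is locally bounded by the norm in a chart. -/
theorem eventually_sqrt_inner_le (g : ContMDiffRiemannianMetric I ∞ E (fun q : N => TangentSpace I q))
    (x₀ : N) : ∃ C : ℝ, ∀ᶠ x in 𝓝 x₀, ∀ v : TangentSpace I x,
      Real.sqrt (g.inner x v v) ≤ C * ‖chartDeriv I x₀ x v‖ := by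
  let : RiemannianBundle (fun q : N => TangentSpace I q) :=
    ⟨g.toContinuousRiemannianMetric.toRiemannianMetric⟩
  have : IsContinuousRiemannianBundle E (fun q : N => TangentSpace I q) :=
    ⟨⟨g.inner, g.contMDiff.continuous, fun b v w ↦ rfl⟩⟩
  obtain ⟨C, hC, h⟩ := eventually_norm_symmL_trivializationAt_lt E (fun q : N => TangentSpace I q) x₀
  refine ⟨C, ?_⟩
  filter_upwards [h, (chartAt H x₀).open_source.mem_nhds (mem_chart_source H x₀)] with x hx hxs v
  have h1 : Real.sqrt (g.inner x v v) = ‖v‖ := (norm_eq_sqrt_real_inner v).symm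
  have h2 : (trivializationAt E (TangentSpace I) x₀).symmL ℝ x (chartDeriv I x₀ x v) = v := by
    rw [chartDeriv, ← TangentBundle.continuousLinearMapAt_trivializationAt hxs]
    exact Trivialization.symmL_continuousLinearMapAt (R := ℝ) (trivializationAt E (TangentSpace I) x₀) hxs v
  rw [h1]
  conv_lhs => rw [← h2]
  exact (ContinuousLinearMap.le_opNorm _ _).trans (mul_le_mul_of_nonneg_right hx.le (norm_nonneg _))

end Metric

/-! ### A bounded primitive from a negative critical value. -/

section Critical

open Bundle Set Filter

variable {n : ℕ}
  {M : Type*} [TopologicalSpace M] [ChartedSpace (Eucl n) M] [IsManifold (𝓡 n) ∞ M]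
  {U : Type*} [TopologicalSpace U] [ChartedSpace (Eucl n) U] [IsManifold (𝓡 n) ∞ U]

theorem abs_apply_le_coNorm_mul (g : Metric n M) (q : M) (ξ : TangentSpace (𝓡 n) q →L[ℝ] ℝ)
    (w : TangentSpace (𝓡 n) q) : |ξ w| ≤ coNorm g q ξ * Real.sqrt (g.inner q w w) := by
  -- Boundedness is needed because `sSup` of an unbounded set of reals is `0` by convention.
  have hbdd : BddAbove {r : ℝ | ∃ v : TangentSpace (𝓡 n) q, g.inner q v v ≤ 1 ∧ r = |ξ v|} := by
    let : RiemannianBundle (fun q : M => TangentSpace (𝓡 n) q) :=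
      ⟨g.toContinuousRiemannianMetric.toRiemannianMetric⟩
    refine ⟨‖ξ‖, ?_⟩
    rintro r ⟨v, hv, rfl⟩
    have h1 : Real.sqrt (g.inner q v v) = ‖v‖ := (norm_eq_sqrt_real_inner v).symm
    refine (ξ.le_opNorm v).trans (mul_le_of_le_one_right (norm_nonneg _) ?_)
    rw [← h1]
    exact Real.sqrt_le_one.2 hv
  rcases eq_or_ne w 0 with rfl | hw
  · simp
  have hpos := g.pos q w hw
  set r := Real.sqrt (g.inner q w w) with hr
  have hr0 : 0 < r := Real.sqrt_pos.2 hpos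
  have hrr : r * r = g.inner q w w := Real.mul_self_sqrt hpos.le
  have h := le_csSup hbdd ⟨r⁻¹ • w, by
    simp only [map_smul, smul_apply, smul_eq_mul, ← hrr]
    field_simp
    exact le_rfl, rfl⟩
  rw [map_smul, smul_eq_mul, abs_mul, abs_inv, abs_of_pos hr0, inv_mul_le_iff₀ hr0] at h
  rwa [mul_comm] at h

omit [IsManifold (𝓡 n) ∞ M] [IsManifold (𝓡 n) ∞ U] in
theorem isInvertible_mfderiv {p : U → M} {x : U} (hp : IsLocalDiffeomorphAt (𝓡 n) (𝓡 n) ∞ p x) :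
    (mfderiv (𝓡 n) (𝓡 n) p x).IsInvertible :=
  ⟨hp.mfderivToContinuousLinearEquiv (by simp), rfl⟩

omit [IsManifold (𝓡 n) ∞ U] in
-- Superlinearity with slope `1` gives `|ξ| ≤ H(q, ξ)` once `|ξ| ≥ R`, so `H < 0` confines the
-- covectors `-θ` to the ball of radius `max R 0`, uniformly in `q`.
theorem isLocallyBoundedOver_of_tonelli_neg {p : U → M}
    (hp : IsLocalDiffeomorph (𝓡 n) (𝓡 n) ∞ p) {H : Cotangent n M → ℝ} (hH : IsTonelli H)
    {θ : OneForm (𝓡 n) U} (hθ : ∀ q : U, H (cotLift p ⟨q, -θ q⟩) < 0) :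
    IsLocallyBoundedOver p θ := by
  obtain ⟨g, hg⟩ := hH.superlinear
  obtain ⟨R, hR⟩ := hg 1
  intro q₀
  obtain ⟨C, hC⟩ := eventually_sqrt_inner_le g q₀
  refine ⟨_, hC, max R 0 * C, fun x hx v => ?_⟩
  set ξ : TangentSpace (𝓡 n) (p x) →L[ℝ] ℝ := (-θ x).comp (mfderiv (𝓡 n) (𝓡 n) p x).inverse
  have hξ : coNorm g (p x) ξ ≤ max R 0 := by
    by_contra! h
    have h1 := hR (p x) ξ ((le_max_left _ _).trans h.le)
    have h2 : H ⟨p x, ξ⟩ < 0 := hθ x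
    linarith [le_max_right R 0]
  have h1 : |ξ (mfderiv (𝓡 n) (𝓡 n) p x v)| = |(θ x : Eucl n →L[ℝ] ℝ) v| := by
    have : (mfderiv (𝓡 n) (𝓡 n) p x).inverse (mfderiv (𝓡 n) (𝓡 n) p x v) = v :=
      (isInvertible_mfderiv (hp x)).inverse_apply_self v
    simp only [ξ, ContinuousLinearMap.comp_apply, this]
    exact abs_neg _
  rw [← h1]
  refine (abs_apply_le_coNorm_mul g (p x) ξ _).trans ?_
  rw [mul_assoc]
  exact mul_le_mul hξ (hx _) (Real.sqrt_nonneg _) (le_max_right _ _)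

omit [IsManifold (𝓡 n) ∞ U] in
theorem exists_isLocallyBoundedOver_of_criticalValue_neg {S : Type*} {p : U → M}
    (hp : IsLocalDiffeomorph (𝓡 n) (𝓡 n) ∞ p) {H : Cotangent n M → ℝ} (hH : IsTonelli H)
    {σ : DForm (𝓡 n) M 2} {i : S → M} (hc : criticalValue p σ i H < 0) :
    ∃ θ ∈ primitivesSub p σ i, IsLocallyBoundedOver p θ := by
  obtain ⟨θ, hθ⟩ := iInf_lt_iff.1 hc
  obtain ⟨hmem, hsup⟩ := iInf_lt_iff.1 hθ
  refine ⟨θ, hmem, isLocallyBoundedOver_of_tonelli_neg hp hH fun q => ?_⟩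
  have := (le_iSup (fun q : U => ((H (cotLift p ⟨q, -θ q⟩) : ℝ) : EReal)) q).trans_lt hsup
  exact_mod_cast this

end Critical

/-! ### A quantitative substitute for the implicit function theorem. -/

section ImplicitZero

open Set Filter

/-- Near a zero at which the derivative of `G` along the second factor does not vanish, every
nearby fibre contains a zero, and tangent vectors of the first factor lift, with a uniform bound,
to vectors annihilated by the derivative of `G`. -/
theorem eventually_exists_zero_of_fderiv_ne_zero {E F : Type*} [NormedAddCommGroup E]
    [NormedSpace ℝ E] [NormedAddCommGroup F] [NormedSpace ℝ F] {G : E × F → ℝ} {a : E} {b η : F}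
    (hG : ContDiffAt ℝ 1 G (a, b)) (h0 : G (a, b) = 0) (hη : fderiv ℝ G (a, b) (0, η) ≠ 0)
    {W : Set (E × F)} (hW : W ∈ 𝓝 (a, b)) :
    ∃ K : ℝ, 0 ≤ K ∧ ∀ᶠ a' in 𝓝 a, ∃ b', (a', b') ∈ W ∧ G (a', b') = 0 ∧ ‖b'‖ ≤ K ∧
      ∀ w : E, ∃ β : F, fderiv ℝ G (a', b') (w, β) = 0 ∧ ‖β‖ ≤ K * ‖w‖ := by
  wlog hpos : 0 < fderiv ℝ G (a, b) (0, η) generalizing η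
  · have hneg : fderiv ℝ G (a, b) (0, -η) = -fderiv ℝ G (a, b) (0, η) := by
      rw [← map_neg, Prod.neg_mk, neg_zero]
    refine this (η := -η) ?_ ?_
    · rw [hneg]
      exact neg_ne_zero.2 hη
    · rw [hneg]
      exact neg_pos.2 (lt_of_le_of_ne (not_lt.1 hpos) hη)
  set c := fderiv ℝ G (a, b) (0, η) with hc
  have hfd : ContinuousAt (fderiv ℝ G) (a, b) :=
    (hG.fderiv_right (m := 0) (by simp)).continuousAt
  have e1 : ∀ᶠ z in 𝓝 (a, b), c / 2 < fderiv ℝ G z (0, η) :=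
    (hfd.clm_apply continuousAt_const).eventually (lt_mem_nhds (half_lt_self hpos))
  have e2 : ∀ᶠ z in 𝓝 (a, b), ‖fderiv ℝ G z‖ < ‖fderiv ℝ G (a, b)‖ + 1 :=
    hfd.norm.eventually (gt_mem_nhds (lt_add_one _))
  have e3 : ∀ᶠ z in 𝓝 (a, b), ContinuousAt G z :=
    (hG.eventually (by simp)).mono fun z hz => hz.continuousAt
  obtain ⟨VA, hVA, VB, hVB, hV⟩ := mem_nhds_prod_iff.1
    ((((eventually_mem_set.2 hW).and e1).and e2).and e3)
  have hline : Tendsto (fun s : ℝ => b + s • η) (𝓝 0) (𝓝 b) := by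
    have : Continuous fun s : ℝ => b + s • η := by fun_prop
    simpa using this.tendsto 0
  obtain ⟨δ₀, hδ₀, hball⟩ := Metric.eventually_nhds_iff_ball.1 (hline.eventually hVB)
  have hder : HasDerivAt (fun s : ℝ => G (a, b + s • η)) c 0 := by
    have h1 : HasDerivAt (fun s : ℝ => (a, b + s • η)) ((0 : E), η) 0 := by
      refine (hasDerivAt_const (0 : ℝ) a).prodMk ?_
      simpa using ((hasDerivAt_id (0 : ℝ)).smul_const η).const_add b
    have h2 : HasFDerivAt G (fderiv ℝ G (a, b)) (a, b + (0 : ℝ) • η) := by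
      simpa using (hG.differentiableAt (by simp)).hasFDerivAt
    exact h2.comp_hasDerivAt (0 : ℝ) h1
  -- `G` vanishes at `(a, b)` with positive slope along `η`, so it changes sign there. The strict
  -- signs at the two endpoints persist for nearby `a'`, and the intermediate value theorem then
  -- gives a zero on the segment.
  have hsign : ∃ δ : ℝ, 0 < δ ∧ δ < δ₀ ∧ 0 < G (a, b + δ • η) ∧ G (a, b + (-δ) • η) < 0 := by
    have hs := hder.tendsto_slope_zero
    have hs' : ∀ᶠ t in 𝓝[≠] (0 : ℝ), 0 < t⁻¹ * G (a, b + t • η) := by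
      have := hs.eventually (lt_mem_nhds hpos)
      simpa [h0] using this
    obtain ⟨δ₁, hδ₁, h⟩ := Metric.eventually_nhds_iff.1 (eventually_nhdsWithin_iff.1 hs')
    have hm : 0 < min δ₀ δ₁ := lt_min hδ₀ hδ₁
    refine ⟨min δ₀ δ₁ / 2, half_pos hm, (half_lt_self hm).trans_le (min_le_left _ _), ?_, ?_⟩
    · have := h (y := min δ₀ δ₁ / 2) (by
        rw [Real.dist_eq, sub_zero, abs_of_pos (half_pos hm)]
        exact (half_lt_self hm).trans_le (min_le_right _ _)) (half_pos hm).ne'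
      exact (pos_iff_pos_of_mul_pos this).1 (inv_pos.2 (half_pos hm))
    · have := h (y := -(min δ₀ δ₁ / 2)) (by
        rw [Real.dist_eq, sub_zero, abs_neg, abs_of_pos (half_pos hm)]
        exact (half_lt_self hm).trans_le (min_le_right _ _)) (neg_ne_zero.2 (half_pos hm).ne')
      exact (neg_iff_neg_of_mul_pos this).1 (inv_lt_zero.2 (neg_lt_zero.2 (half_pos hm)))
  obtain ⟨δ, hδ, hδδ, hGp, hGn⟩ := hsign
  have hmemB : ∀ s ∈ Icc (-δ) δ, b + s • η ∈ VB := by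
    intro s hs
    refine hball s ?_
    rw [Metric.mem_ball, Real.dist_eq, sub_zero]
    exact (abs_le.2 hs).trans_lt hδδ
  have hmem : ∀ a' ∈ VA, ∀ s ∈ Icc (-δ) δ, (a', b + s • η) ∈ VA ×ˢ VB :=
    fun a' ha' s hs => ⟨ha', hmemB s hs⟩
  have hcontA (s : ℝ) (hs : s ∈ Icc (-δ) δ) : ContinuousAt (fun a' => G (a', b + s • η)) a := by
    have h1 := (hV (hmem a (mem_of_mem_nhds hVA) s hs)).2
    exact ContinuousAt.comp (f := fun a' => (a', b + s • η)) h1 (by fun_prop)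
  have f1 := (hcontA δ ⟨by linarith, le_rfl⟩).eventually (lt_mem_nhds hGp)
  have f2 := (hcontA (-δ) ⟨le_rfl, by linarith⟩).eventually (gt_mem_nhds hGn)
  set K₁ := (‖fderiv ℝ G (a, b)‖ + 1) / (c / 2) * ‖η‖ with hK₁
  have hK₁0 : 0 ≤ K₁ := by positivity
  refine ⟨max (‖b‖ + δ * ‖η‖) K₁, hK₁0.trans (le_max_right _ _), ?_⟩
  filter_upwards [hVA, f1, f2] with a' ha' hp hn
  have hcont : ContinuousOn (fun s : ℝ => G (a', b + s • η)) (Icc (-δ) δ) := fun s hs =>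
    (ContinuousAt.comp (f := fun s : ℝ => (a', b + s • η)) (hV (hmem a' ha' s hs)).2
      (by fun_prop)).continuousWithinAt
  obtain ⟨s, hs, hs0⟩ := intermediate_value_Icc (by linarith) hcont ⟨hn.le, hp.le⟩
  obtain ⟨⟨⟨hW', hc'⟩, hn'⟩, -⟩ := hV (hmem a' ha' s hs)
  refine ⟨b + s • η, hW', hs0, ?_, fun w => ?_⟩
  · refine le_trans ((norm_add_le _ _).trans ?_) (le_max_left _ _)
    rw [norm_smul, Real.norm_eq_abs]
    gcongr
    exact abs_le.2 hs
  · set L := fderiv ℝ G (a', b + s • η)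
    have hL : 0 < L (0, η) := (half_pos hpos).trans hc'
    -- Correcting `(w, 0)` along `η` alone suffices: the denominator stays above `c / 2` and the
    -- numerator is at most `(‖fderiv ℝ G (a, b)‖ + 1)‖w‖`, whence `K₁`.
    refine ⟨-(L (w, 0) / L (0, η)) • η, ?_, ?_⟩
    · have : (w, -(L (w, 0) / L (0, η)) • η) = (w, (0 : F)) + (-(L (w, 0) / L (0, η))) • ((0 : E), η) := by
        ext <;> simp
      rw [this, map_add, map_smul, smul_eq_mul]
      field_simp
      ring
    · rw [norm_smul, norm_neg, norm_div, Real.norm_of_nonneg hL.le]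
      have h1 : ‖L (w, 0)‖ ≤ (‖fderiv ℝ G (a, b)‖ + 1) * ‖w‖ := by
        refine (L.le_opNorm _).trans ?_
        rw [Prod.norm_mk, norm_zero, max_eq_left (norm_nonneg w)]
        gcongr
      calc ‖L (w, 0)‖ / L (0, η) * ‖η‖
          ≤ (‖fderiv ℝ G (a, b)‖ + 1) * ‖w‖ / (c / 2) * ‖η‖ := by gcongr
        _ = K₁ * ‖w‖ := by rw [hK₁]; ring
        _ ≤ _ := by gcongr; exact le_max_right _ _

end ImplicitZero

/-! ### Smoothness and local invertibility of the induced map of cotangent bundles. -/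

section CotLift

open Set Bundle Filter

variable {n : ℕ}
  {M : Type*} [TopologicalSpace M] [ChartedSpace (Eucl n) M] [IsManifold (𝓡 n) ∞ M]
  {U : Type*} [TopologicalSpace U] [ChartedSpace (Eucl n) U] [IsManifold (𝓡 n) ∞ U]

/-- The fibre coordinate of a covector in the bundle trivialization at `q₀`. -/
theorem inCoordinates_cotangent {q₀ q : M} (ξ : TangentSpace (𝓡 n) q →L[ℝ] ℝ) :
    ContinuousLinearMap.inCoordinates (Eucl n) (TangentSpace (𝓡 n)) ℝ (fun _ : M => ℝ) q₀ q q₀ q ξ =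
      ξ.comp ((trivializationAt (Eucl n) (TangentSpace (𝓡 n)) q₀).symmL ℝ q) := by
  ext u
  simp [ContinuousLinearMap.inCoordinates]

/-- In bundle coordinates the fibre part is precomposition with the inverse of the coordinate matrix
of `dp`, and inversion of operators is smooth at invertible ones. -/
theorem contMDiffAt_cotLift {p : U → M} {x₀ : Cotangent n U}
    (hp : ContMDiffAt (𝓡 n) (𝓡 n) ∞ p x₀.proj)
    (hinv : (mfderiv (𝓡 n) (𝓡 n) p x₀.proj).IsInvertible) :
    ContMDiffAt (cotModel n) (cotModel n) ∞ (cotLift p) x₀ := by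
  have hproj : ContMDiffAt (cotModel n) (𝓡 n) ∞ (fun y : Cotangent n U => y.proj) x₀ :=
    contMDiff_cotangent_proj x₀
  have hbase : ContMDiffAt (cotModel n) (𝓡 n) ∞ (fun y : Cotangent n U => p y.proj) x₀ :=
    ContMDiffAt.comp x₀ hp hproj
  refine (contMDiffAt_hom_bundle (cotLift p)).2 ⟨hbase, ?_⟩
  set A : U → Eucl n →L[ℝ] Eucl n :=
    inTangentCoordinates (𝓡 n) (𝓡 n) id p (mfderiv (𝓡 n) (𝓡 n) p) x₀.proj with hA_def
  have hA : ContMDiffAt (𝓡 n) 𝓘(ℝ, Eucl n →L[ℝ] Eucl n) ∞ A x₀.proj := hp.mfderiv_const (by simp)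
  have hAeq (q : U)
      (h1 : q ∈ (trivializationAt (Eucl n) (TangentSpace (𝓡 n)) x₀.proj).baseSet)
      (h2 : p q ∈ (trivializationAt (Eucl n) (TangentSpace (𝓡 n)) (p x₀.proj)).baseSet) :
      A q = ((trivializationAt (Eucl n) (TangentSpace (𝓡 n)) (p x₀.proj)).continuousLinearEquivAt
          ℝ (p q) h2 : TangentSpace (𝓡 n) (p q) →L[ℝ] Eucl n) ∘L
        (mfderiv (𝓡 n) (𝓡 n) p q ∘L
          (((trivializationAt (Eucl n) (TangentSpace (𝓡 n)) x₀.proj).continuousLinearEquivAt ℝ q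
            h1).symm : Eucl n →L[ℝ] TangentSpace (𝓡 n) q)) :=
    ContinuousLinearMap.inCoordinates_eq h1 h2
  have hb1 := FiberBundle.mem_baseSet_trivializationAt' (F := Eucl n)
    (E := (TangentSpace (𝓡 n) : U → Type _)) x₀.proj
  have hb2 := FiberBundle.mem_baseSet_trivializationAt' (F := Eucl n)
    (E := (TangentSpace (𝓡 n) : M → Type _)) (p x₀.proj)
  have hAinv : ContMDiffAt (𝓡 n) 𝓘(ℝ, Eucl n →L[ℝ] Eucl n) ∞ (fun q => (A q).inverse) x₀.proj := by
    obtain ⟨D, hD⟩ := hinv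
    have h0 := hAeq x₀.proj hb1 hb2
    rw [← hD] at h0
    have h3 := contDiffAt_map_inverse (𝕜 := ℝ) (n := ∞)
      (((trivializationAt (Eucl n) (TangentSpace (𝓡 n)) x₀.proj).continuousLinearEquivAt ℝ
        x₀.proj hb1).symm.trans (D.trans ((trivializationAt (Eucl n) (TangentSpace (𝓡 n))
          (p x₀.proj)).continuousLinearEquivAt ℝ (p x₀.proj) hb2)))
    have h4 : ContDiffAt ℝ ∞ ContinuousLinearMap.inverse (A x₀.proj) := by
      rw [h0]
      exact h3
    exact h4.contMDiffAt.comp x₀.proj hA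
  have hid : ContMDiffAt (cotModel n) 𝓘(ℝ, Eucl n →L[ℝ] ℝ) ∞ (fun x : Cotangent n U =>
      ContinuousLinearMap.inCoordinates (Eucl n) (TangentSpace (𝓡 n)) ℝ (fun _ : U => ℝ)
        x₀.proj x.proj x₀.proj x.proj x.2) x₀ :=
    ((contMDiffAt_hom_bundle (fun x : Cotangent n U => x)).1 contMDiffAt_id).2
  refine (hid.clm_comp (hAinv.comp x₀ hproj)).congr_of_eventuallyEq ?_
  have e1 := hproj.continuousAt.preimage_mem_nhds
    ((trivializationAt (Eucl n) (TangentSpace (𝓡 n)) x₀.proj).open_baseSet.mem_nhds hb1)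
  have e2 := hbase.continuousAt.preimage_mem_nhds
    ((trivializationAt (Eucl n) (TangentSpace (𝓡 n)) (p x₀.proj)).open_baseSet.mem_nhds hb2)
  filter_upwards [e1, e2] with x h1 h2
  refine (inCoordinates_cotangent _).trans ?_
  rw [inCoordinates_cotangent]
  simp only [Function.comp_apply]
  rw [hAeq x.proj h1 h2, ContinuousLinearMap.inverse_equiv_comp,
    ContinuousLinearMap.inverse_comp_equiv]
  refine ContinuousLinearMap.ext fun v => ?_
  have k1 := congrFun (Trivialization.symm_continuousLinearEquivAt_eq (R := ℝ)
    (trivializationAt (Eucl n) (TangentSpace (𝓡 n)) x₀.proj) h1)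
  have k2 := congrFun (Trivialization.symm_continuousLinearEquivAt_eq (R := ℝ)
    (trivializationAt (Eucl n) (TangentSpace (𝓡 n)) (p x₀.proj)) h2) v
  have k3 := ContinuousLinearEquiv.symm_apply_apply
    ((trivializationAt (Eucl n) (TangentSpace (𝓡 n)) x₀.proj).continuousLinearEquivAt ℝ x.proj h1)
    ((mfderiv (𝓡 n) (𝓡 n) p x.proj).inverse
      (((trivializationAt (Eucl n) (TangentSpace (𝓡 n)) (p x₀.proj)).continuousLinearEquivAt ℝ
        (p x.proj) h2).symm v))
  rw [k1] at k3
  exact congrArg x.2 ((congrArg (mfderiv (𝓡 n) (𝓡 n) p x.proj).inverse k2).symm.trans k3.symm)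

omit [IsManifold (𝓡 n) ∞ M] in
theorem cotangent_ext {x y : Cotangent n M} (h : x.proj = y.proj)
    (h' : (x.2 : Eucl n →L[ℝ] ℝ) = (y.2 : Eucl n →L[ℝ] ℝ)) : x = y := by
  cases x
  cases y
  cases h
  cases h'
  rfl

omit [IsManifold (𝓡 n) ∞ M] [IsManifold (𝓡 n) ∞ U] in
theorem cotLift_comp_mfderiv {p : U → M} (hp : IsLocalDiffeomorph (𝓡 n) (𝓡 n) ∞ p) (x : U)
    (ξ : TangentSpace (𝓡 n) (p x) →L[ℝ] ℝ) :
    cotLift p ⟨x, ξ.comp (mfderiv (𝓡 n) (𝓡 n) p x)⟩ = ⟨p x, ξ⟩ := by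
  refine cotangent_ext rfl (ContinuousLinearMap.ext fun v => ?_)
  exact congrArg ξ ((isInvertible_mfderiv (hp x)).self_apply_inverse v)

theorem contMDiff_cotLift {p : U → M} (hp : IsLocalDiffeomorph (𝓡 n) (𝓡 n) ∞ p) :
    ContMDiff (cotModel n) (cotModel n) ∞ (cotLift (n := n) p) := fun x =>
  contMDiffAt_cotLift (hp.contMDiff x.proj) (isInvertible_mfderiv (hp x.proj))

theorem dProj_mfderiv_cotLift {p : U → M} (hp : IsLocalDiffeomorph (𝓡 n) (𝓡 n) ∞ p)
    (x : Cotangent n U) (v : TangentSpace (cotModel n) x) :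
    dProj (cotLift p x) (mfderiv (cotModel n) (cotModel n) (cotLift p) x v) =
      mfderiv (𝓡 n) (𝓡 n) p x.proj (dProj x v) := by
  have h1 := ((contMDiff_cotangent_proj (n := n) (N := M)).mdifferentiable (by simp)
    (cotLift p x)).hasMFDerivAt.comp x
    ((contMDiff_cotLift hp).mdifferentiable (by simp) x).hasMFDerivAt
  have h2 := (hp.mdifferentiable (by simp) x.proj).hasMFDerivAt.comp x
    ((contMDiff_cotangent_proj (n := n) (N := U)).mdifferentiable (by simp) x).hasMFDerivAt
  exact congrArg (fun L : (Eucl n × (Eucl n →L[ℝ] ℝ)) →L[ℝ] Eucl n => L v)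
    (hasMFDerivAt_unique h1 h2)

omit [IsManifold (𝓡 n) ∞ M] in
-- The construction is functorial: the differentials of `p` and of its local inverse are mutually
-- inverse, so the two precompositions cancel.
theorem eventually_cotLift_localInverse {p : U → M} (hp : IsLocalDiffeomorph (𝓡 n) (𝓡 n) ∞ p)
    (x : Cotangent n U) :
    cotLift (hp x.proj).localInverse ∘ cotLift p =ᶠ[𝓝 x] id := by
  set h := hp x.proj
  have hpr : ContinuousAt (fun y : Cotangent n U => y.proj) x :=
    (contMDiff_cotangent_proj (n := n) (N := U)).continuous.continuousAt
  have e1 : ∀ᶠ q in 𝓝 x.proj, p q ∈ h.localInverse.source :=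
    (hp.contMDiff x.proj).continuousAt.preimage_mem_nhds
      (h.localInverse_open_source.mem_nhds h.localInverse_mem_source)
  have e2 := h.localInverse_eventuallyEq_left.eventuallyEq_nhds
  filter_upwards [hpr.eventually e1, hpr.eventually e2] with y h1 h2
  refine cotangent_ext h2.self_of_nhds ?_
  have hd : MDifferentiableAt (𝓡 n) (𝓡 n) h.localInverse (p y.proj) :=
    (h.localInverse_contMDiffOn.contMDiffAt
      (h.localInverse_open_source.mem_nhds h1)).mdifferentiableAt (by simp)
  obtain ⟨D, hD⟩ := isInvertible_mfderiv (hp y.proj)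
  let B : Eucl n →L[ℝ] Eucl n := mfderiv (𝓡 n) (𝓡 n) h.localInverse (p y.proj)
  let D' : Eucl n ≃L[ℝ] Eucl n := D
  have h3 : B.comp (D' : Eucl n →L[ℝ] Eucl n) = ContinuousLinearMap.id ℝ (Eucl n) := by
    have h4 := hd.hasMFDerivAt.comp y.proj (hp.mdifferentiable (by simp) y.proj).hasMFDerivAt
    rw [← hD] at h4
    exact hasMFDerivAt_unique h4 ((hasMFDerivAt_id y.proj).congr_of_eventuallyEq h2)
  have h5 : B = (D'.symm : Eucl n →L[ℝ] Eucl n) := by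
    ext1 v
    have := congrArg (fun L : Eucl n →L[ℝ] Eucl n => L (D'.symm v)) h3
    simpa using this
  have h6 : B.inverse = (D' : Eucl n →L[ℝ] Eucl n) := by
    rw [h5, ContinuousLinearMap.inverse_equiv, D'.symm_symm]
  change ((y.2 : Eucl n →L[ℝ] ℝ).comp (mfderiv (𝓡 n) (𝓡 n) p y.proj).inverse).comp B.inverse = y.2
  rw [h6, ← hD, ContinuousLinearMap.inverse_equiv]
  exact ContinuousLinearMap.ext fun v => congrArg y.2 (D'.symm_apply_apply v)

/-- The lift of a local inverse provides a left inverse of the differential, and in equal finite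
dimensions injectivity gives surjectivity. This serves to lift vectors tangent to `Σ` upstairs. -/
theorem mfderiv_cotLift_surjective {p : U → M} (hp : IsLocalDiffeomorph (𝓡 n) (𝓡 n) ∞ p)
    (x : Cotangent n U) :
    Function.Surjective (mfderiv (cotModel n) (cotModel n) (cotLift p) x) := by
  have h := hp x.proj
  have he : MDifferentiableAt (cotModel n) (cotModel n) (cotLift h.localInverse) (cotLift p x) :=
    (contMDiffAt_cotLift (x₀ := cotLift p x) h.localInverse_contMDiffAt
      (isInvertible_mfderiv h.localInverse_isLocalDiffeomorphAt)).mdifferentiableAt (by simp)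
  have h1 := he.hasMFDerivAt.comp x ((contMDiff_cotLift hp).mdifferentiable (by simp) x).hasMFDerivAt
  have h2 := hasMFDerivAt_unique h1
    ((hasMFDerivAt_id x).congr_of_eventuallyEq (eventually_cotLift_localInverse hp x))
  let D : (Eucl n × (Eucl n →L[ℝ] ℝ)) →L[ℝ] (Eucl n × (Eucl n →L[ℝ] ℝ)) :=
    mfderiv (cotModel n) (cotModel n) (cotLift p) x
  let B : (Eucl n × (Eucl n →L[ℝ] ℝ)) →L[ℝ] (Eucl n × (Eucl n →L[ℝ] ℝ)) :=
    mfderiv (cotModel n) (cotModel n) (cotLift h.localInverse) (cotLift p x)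
  have h3 : Function.LeftInverse B D := fun v =>
    congrArg (fun L : (Eucl n × (Eucl n →L[ℝ] ℝ)) →L[ℝ] (Eucl n × (Eucl n →L[ℝ] ℝ)) => L v) h2
  exact (LinearMap.injective_iff_surjective (f := D.toLinearMap)).1 h3.injective

end CotLift

/-! ### A bounded primitive from positivity of `λ_θ` on the hypersurface. -/

section Hypersurface

open Set Bundle Filter

variable {n : ℕ}
  {M : Type*} [TopologicalSpace M] [ChartedSpace (Eucl n) M] [IsManifold (𝓡 n) ∞ M]
  {U : Type*} [TopologicalSpace U] [ChartedSpace (Eucl n) U] [IsManifold (𝓡 n) ∞ U]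

/-- If `λ_θ` does not vanish on the symplectic gradient of `H`, then `H` is not vertically
critical. -/
theorem exists_mfderiv_vertical_ne_zero {p : U → M} (hp : IsLocalDiffeomorph (𝓡 n) (𝓡 n) ∞ p)
    {H : Cotangent n M → ℝ} (hH : ContMDiff (cotModel n) 𝓘(ℝ, ℝ) ∞ H) {τ : DForm (𝓡 n) U 2}
    {θ : OneForm (𝓡 n) U} {X : ∀ x : Cotangent n U, TangentSpace (cotModel n) x}
    (hX : IsSymplecticGradient (twistedForm τ) (H ∘ cotLift p) X) {x : Cotangent n U}
    (hx : lambdaForm θ x (X x) ≠ 0) :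
    ∃ η : Eucl n →L[ℝ] ℝ, (mfderiv (cotModel n) 𝓘(ℝ, ℝ) H (cotLift p x) :
      (Eucl n × (Eucl n →L[ℝ] ℝ)) →L[ℝ] ℝ) ((0 : Eucl n), η) ≠ 0 := by
  by_contra! h
  let X₀ : Eucl n × (Eucl n →L[ℝ] ℝ) := X x
  -- Pair `X` with a vertical vector `(0, η)`: the pulled-back form `τ` kills it and `dλ₀` gives
  -- `-η(X₀.1)`, while `dH̃` vanishes on it by assumption. So `X` is vertical, and both terms of
  -- `λ_θ` vanish on it.
  have hX0 (η : Eucl n →L[ℝ] ℝ) : η X₀.1 = 0 := by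
    let w : Eucl n × (Eucl n →L[ℝ] ℝ) := (0, η)
    have hw0 : dProj x w = 0 := dProj_eq_fst x w
    have h1 := hX x w
    have h2 : mfderiv (cotModel n) 𝓘(ℝ, ℝ) (H ∘ cotLift p) x w = (0 : ℝ) := by
      rw [mfderiv_comp x (hH.mdifferentiable (by simp) _)
        ((contMDiff_cotLift hp).mdifferentiable (by simp) x)]
      let w' : Eucl n × (Eucl n →L[ℝ] ℝ) := mfderiv (cotModel n) (cotModel n) (cotLift p) x w
      have h3 : w'.1 = 0 := by
        rw [← dProj_eq_fst (cotLift p x) w']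
        refine (dProj_mfderiv_cotLift hp x w).trans ?_
        rw [hw0, map_zero]
        rfl
      have h4 : w' = ((0 : Eucl n), w'.2) := Prod.ext h3 rfl
      refine Eq.trans ?_ (h w'.2)
      rw [← h4]
      rfl
    replace h1 := h1.trans ((congrArg Neg.neg h2).trans neg_zero)
    have h5 : DForm.pullback (cotModel n) (fun y : Cotangent n U => y.proj) τ x ![X x, w] = 0 :=
      (τ x.proj).map_coord_zero (1 : Fin 2) hw0
    have h6 := liouville_d_apply x X₀ w
    have h7 : ((liouville (n := n) (N := U)).toDForm.d x :
      (Eucl n × (Eucl n →L[ℝ] ℝ)) [⋀^Fin 2]→L[ℝ] ℝ) ![X₀, w] +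
      DForm.pullback (cotModel n) (fun y : Cotangent n U => y.proj) τ x ![X x, w] = 0 := h1
    rw [h5, h6, add_zero] at h7
    simpa [w] using h7
  have h0 : X₀.1 = 0 := by
    have := hX0 (innerSL ℝ X₀.1)
    simpa using this
  have h1 : dProj x (X x) = 0 := (dProj_eq_fst x (X x)).trans h0
  refine hx ?_
  change x.2 (dProj x (X x)) + θ x.proj (dProj x (X x)) = 0
  rw [h1, map_zero, map_zero, add_zero]

/-- Near a zero of `H` that is not vertically critical, `H` has zeros over all points of `M`, and
tangent vectors of `M` lift to tangent vectors of the zero set, with uniform bounds. -/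
theorem eventually_exists_zero_of_mfderiv_vertical_ne_zero {H : Cotangent n M → ℝ}
    (hH : ContMDiff (cotModel n) 𝓘(ℝ, ℝ) ∞ H) {y₀ : Cotangent n M} (h0 : H y₀ = 0)
    {η : Eucl n →L[ℝ] ℝ} (hη : (mfderiv (cotModel n) 𝓘(ℝ, ℝ) H y₀ :
      (Eucl n × (Eucl n →L[ℝ] ℝ)) →L[ℝ] ℝ) ((0 : Eucl n), η) ≠ 0)
    {W : Set (Cotangent n M)} (hW : W ∈ 𝓝 y₀) :
    ∃ K : ℝ, 0 ≤ K ∧ ∀ᶠ q in 𝓝 y₀.proj, ∃ ξ : TangentSpace (𝓡 n) q →L[ℝ] ℝ,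
      (⟨q, ξ⟩ : Cotangent n M) ∈ W ∧ H ⟨q, ξ⟩ = 0 ∧ ∀ w : TangentSpace (𝓡 n) q,
        |ξ w| ≤ K * ‖chartDeriv (𝓡 n) y₀.proj q w‖ ∧
        ∃ v : Eucl n × (Eucl n →L[ℝ] ℝ), dProj (⟨q, ξ⟩ : Cotangent n M) v = w ∧
          (mfderiv (cotModel n) 𝓘(ℝ, ℝ) H ⟨q, ξ⟩ : (Eucl n × (Eucl n →L[ℝ] ℝ)) →L[ℝ] ℝ) v = 0 ∧
          ‖chartDeriv (cotModel n) y₀ (⟨q, ξ⟩ : Cotangent n M) v‖ ≤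
            K * ‖chartDeriv (𝓡 n) y₀.proj q w‖ := by
  set φ := extChartAt (cotModel n) y₀ with hφ
  set G : Eucl n × (Eucl n →L[ℝ] ℝ) → ℝ := H ∘ φ.symm with hG_def
  have htgt : φ.target ∈ 𝓝 (φ y₀) := extChartAt_target_mem_nhds (I := cotModel n) y₀
  have hG : ContDiffOn ℝ ∞ G φ.target :=
    (hH.comp_contMDiffOn (contMDiffOn_extChartAt_symm y₀)).contDiffOn
  have hGd (y : Cotangent n M) (hy : y ∈ φ.source) (v : Eucl n × (Eucl n →L[ℝ] ℝ)) :
      fderiv ℝ G (φ y) (chartDeriv (cotModel n) y₀ y v) =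
        (mfderiv (cotModel n) 𝓘(ℝ, ℝ) H y : (Eucl n × (Eucl n →L[ℝ] ℝ)) →L[ℝ] ℝ) v := by
    have hy' : y ∈ (chartAt (ModelProd (Eucl n) (Eucl n →L[ℝ] ℝ)) y₀).source := by
      rwa [← extChartAt_source (cotModel n)]
    have h1 : HasFDerivAt G (fderiv ℝ G (φ y)) (φ y) :=
      ((hG.contDiffAt ((isOpen_extChartAt_target (I := cotModel n) y₀).mem_nhds
        (φ.map_source hy))).differentiableAt (by simp)).hasFDerivAt
    have h2 := h1.hasMFDerivAt.comp y
      (mdifferentiableAt_extChartAt (I := cotModel n) hy').hasMFDerivAt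
    have h3 : G ∘ φ =ᶠ[𝓝 y] H := by
      filter_upwards [(isOpen_extChartAt_source (I := cotModel n) y₀).mem_nhds hy] with z hz
      exact congrArg H (φ.left_inv hz)
    have h4 := (hH.mdifferentiable (by simp) y).hasMFDerivAt.congr_of_eventuallyEq h3
    exact congrArg (fun L : (Eucl n × (Eucl n →L[ℝ] ℝ)) →L[ℝ] ℝ => L v)
      (hasMFDerivAt_unique h2 h4)
  have hGη : fderiv ℝ G (φ y₀) (0, η) ≠ 0 := by
    have h1 := hGd y₀ (mem_extChartAt_source y₀) (0, η)
    have h2 : chartDeriv (cotModel n) y₀ y₀ ((0 : Eucl n), η) = (0, η) :=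
      congrArg (fun L : (Eucl n × (Eucl n →L[ℝ] ℝ)) →L[ℝ] (Eucl n × (Eucl n →L[ℝ] ℝ)) =>
        L ((0 : Eucl n), η)) (mfderiv_extChartAt_self (I := cotModel n) (x := y₀))
    rw [h2] at h1
    rwa [h1]
  have hG0 : G (φ y₀) = 0 := (congrArg H (φ.left_inv (mem_extChartAt_source y₀))).trans h0
  have hW' : φ.symm ⁻¹' W ∩ φ.target ∈ 𝓝 (φ y₀) :=
    inter_mem (extChartAt_preimage_mem_nhds hW) htgt
  obtain ⟨K, hK, hev⟩ := eventually_exists_zero_of_fderiv_ne_zero (a := (φ y₀).1) (b := (φ y₀).2)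
    ((hG.contDiffAt htgt).of_le (by simp)) hG0 hGη hW'
  -- The `1` accounts for the horizontal component of the lifted vector, which is `w` itself in the
  -- chart; `K` bounds the fibre component.
  refine ⟨max 1 K, zero_le_one.trans (le_max_left _ _), ?_⟩
  rw [hφ, extChartAt_cotangent_apply_fst] at hev
  filter_upwards [(continuousAt_extChartAt (I := 𝓡 n) y₀.proj).eventually hev,
    extChartAt_source_mem_nhds (I := 𝓡 n) y₀.proj] with q hq hqs
  obtain ⟨b', ⟨hbW, hbt⟩, hb0, hbK, hb⟩ := hq
  have hyproj := extChartAt_cotangent_symm_proj hbt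
  have hφy := φ.right_inv hbt
  have hys := φ.map_target hbt
  rw [(extChartAt (𝓡 n) y₀.proj).left_inv hqs] at hyproj
  replace hbW : φ.symm (extChartAt (𝓡 n) y₀.proj q, b') ∈ W := hbW
  replace hb0 : H (φ.symm (extChartAt (𝓡 n) y₀.proj q, b')) = 0 := hb0
  generalize φ.symm (extChartAt (𝓡 n) y₀.proj q, b') = y at hyproj hφy hys hbW hb0
  subst hyproj
  have hqs' : y.proj ∈ (chartAt (Eucl n) y₀.proj).source := by
    rwa [extChartAt_source] at hqs
  refine ⟨y.2, hbW, hb0, fun w => ?_⟩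
  let w' : Eucl n := chartDeriv (𝓡 n) y₀.proj y.proj w
  constructor
  · have h1 : b' w' = y.2 w := by
      have h2 := extChartAt_cotangent_apply_snd hqs' w
      rw [← hφ, hφy] at h2
      exact h2
    rw [← h1, ← Real.norm_eq_abs]
    refine (b'.le_opNorm w').trans ?_
    exact mul_le_mul_of_nonneg_right (hbK.trans (le_max_right _ _)) (norm_nonneg _)
  · obtain ⟨β, hβ0, hβ⟩ := hb w'
    obtain ⟨D, hD⟩ := isInvertible_mfderiv_extChartAt (I := cotModel n) hys
    let D' : (Eucl n × (Eucl n →L[ℝ] ℝ)) ≃L[ℝ] (Eucl n × (Eucl n →L[ℝ] ℝ)) := D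
    have hD' : chartDeriv (cotModel n) y₀ y (D'.symm (w', β)) = (w', β) := by
      rw [chartDeriv, ← hφ, ← hD]
      exact D'.apply_symm_apply (w', β)
    refine ⟨D'.symm (w', β), ?_, ?_, ?_⟩
    · obtain ⟨B, hB⟩ := isInvertible_mfderiv_extChartAt (I := 𝓡 n) hqs
      have h1 := mfderiv_extChartAt_cotangent_fst hqs' (D'.symm (w', β))
      have h2 : w' = mfderiv (𝓡 n) 𝓘(ℝ, Eucl n) (extChartAt (𝓡 n) y₀.proj) y.proj
          (dProj y (D'.symm (w', β))) := (congrArg Prod.fst hD').symm.trans h1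
      have h3 : B w = B (dProj y (D'.symm (w', β))) := by
        have h4 := h2
        rw [← hB] at h4
        refine Eq.trans ?_ h4
        simp only [w', chartDeriv]
        rw [← hB]
        rfl
      exact (B.injective h3).symm
    · rw [← hGd y hys, hD', hφy]
      exact hβ0
    · change ‖chartDeriv (cotModel n) y₀ y (D'.symm (w', β))‖ ≤ max 1 K * ‖w'‖
      rw [hD', Prod.norm_mk]
      refine max_le ?_ (hβ.trans ?_)
      · exact le_mul_of_one_le_left (norm_nonneg _) (le_max_left _ _)
      · exact mul_le_mul_of_nonneg_right (le_max_right _ _) (norm_nonneg _)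

/-- A compact zero set of `H` without vertically critical points projects onto `M`. -/
theorem image_proj_eq_univ [T2Space M] [PreconnectedSpace M] {H : Cotangent n M → ℝ}
    (hH : ContMDiff (cotModel n) 𝓘(ℝ, ℝ) ∞ H) {Sig : Set (Cotangent n M)} (hc : IsCompact Sig)
    (hne : Sig.Nonempty) (hSig : Sig = {x | H x = 0})
    (hv : ∀ y ∈ Sig, ∃ η : Eucl n →L[ℝ] ℝ, (mfderiv (cotModel n) 𝓘(ℝ, ℝ) H y :
      (Eucl n × (Eucl n →L[ℝ] ℝ)) →L[ℝ] ℝ) ((0 : Eucl n), η) ≠ 0) :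
    (fun y : Cotangent n M => y.proj) '' Sig = univ := by
  -- The image is closed by compactness, and open because zeros persist over nearby base points.
  refine IsClopen.eq_univ ⟨(hc.image (contMDiff_cotangent_proj (n := n)).continuous).isClosed,
    isOpen_iff_mem_nhds.2 ?_⟩ (hne.image _)
  rintro _ ⟨y₀, hy₀, rfl⟩
  obtain ⟨η, hη⟩ := hv y₀ hy₀
  rw [hSig] at hy₀
  obtain ⟨K, -, hK⟩ := eventually_exists_zero_of_mfderiv_vertical_ne_zero hH hy₀ hη univ_mem
  filter_upwards [hK] with q hq
  obtain ⟨ξ, -, h0, -⟩ := hq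
  exact ⟨⟨q, ξ⟩, hSig ▸ h0, rfl⟩

/-- For a tangent vector `v` of `U`, lift `dp v` to a vector tangent to `Σ`, then to a vector `u`
tangent to the preimage of `Σ`. There `λ_θ(u) = ξ(dp v) + θ(v)`, and both `λ_θ(u)` and `ξ(dp v)` are
bounded by the chart norm of `dp v`. -/
theorem isLocallyBoundedOver_of_mem_primitivesHyp [T2Space M] [PreconnectedSpace M] {p : U → M}
    (hp : IsLocalDiffeomorph (𝓡 n) (𝓡 n) ∞ p) (hps : Function.Surjective p)
    {σ : DForm (𝓡 n) M 2} {Sig : Set (Cotangent n M)} (hc : IsCompact Sig) (hne : Sig.Nonempty)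
    {θ : OneForm (𝓡 n) U} (hθ : θ ∈ primitivesHyp p σ Sig) : IsLocallyBoundedOver p θ := by
  obtain ⟨-, H, hH, ⟨g, C, hC⟩, X, ε, hX, hε, hXε⟩ := hθ
  have hs := hH.tonelli.smooth
  have hv (y : Cotangent n M) (hy : y ∈ Sig) : ∃ η : Eucl n →L[ℝ] ℝ,
      (mfderiv (cotModel n) 𝓘(ℝ, ℝ) H y : (Eucl n × (Eucl n →L[ℝ] ℝ)) →L[ℝ] ℝ)
        ((0 : Eucl n), η) ≠ 0 := by
    obtain ⟨q, ξ⟩ := y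
    obtain ⟨x, rfl⟩ := hps q
    rw [← cotLift_comp_mfderiv hp] at hy ⊢
    exact exists_mfderiv_vertical_ne_zero hp hs hX (hε.trans_le (hXε _ hy)).ne'
  intro q₀
  obtain ⟨y₀, hy₀, rfl⟩ : q₀ ∈ (fun y : Cotangent n M => y.proj) '' Sig := by
    rw [image_proj_eq_univ hs hc hne hH.eq_zeroSet hv]
    exact mem_univ _
  obtain ⟨η, hη⟩ := hv y₀ hy₀
  rw [hH.eq_zeroSet] at hy₀
  obtain ⟨C₁, hC₁⟩ := eventually_sqrt_inner_le g y₀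
  obtain ⟨K, hK, hev⟩ := eventually_exists_zero_of_mfderiv_vertical_ne_zero hs hy₀ hη hC₁
  refine ⟨_, hev, |C| * |C₁| * K + K, fun x hx v => ?_⟩
  obtain ⟨ξ, hW, hξ0, hξ⟩ := hx
  obtain ⟨h1, v', h2, h3, h4⟩ := hξ (mfderiv (𝓡 n) (𝓡 n) p x v)
  set r := ‖chartDeriv (𝓡 n) y₀.proj (p x) (mfderiv (𝓡 n) (𝓡 n) p x v)‖
  have hlift := cotLift_comp_mfderiv hp x ξ
  set x' : Cotangent n U := ⟨x, ξ.comp (mfderiv (𝓡 n) (𝓡 n) p x)⟩ with hx'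
  rw [← hlift] at hW hξ0 h3 h4
  have hmem : cotLift p x' ∈ Sig := by rw [hH.eq_zeroSet]; exact hξ0
  obtain ⟨u, hu⟩ := mfderiv_cotLift_surjective hp x' v'
  have hu1 : dProj x' u = v := by
    have h5 := dProj_mfderiv_cotLift hp x' u
    rw [hu] at h5
    have h6 := h5.symm.trans ((dProj_eq_fst (cotLift p x') v').trans
      ((dProj_eq_fst (⟨p x, ξ⟩ : Cotangent n M) v').symm.trans h2))
    obtain ⟨D, hD⟩ := isInvertible_mfderiv (hp x)
    have h7 : D (dProj x' u) = D v := by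
      refine Eq.trans ?_ (h6.trans ?_)
      · exact congrArg (fun L : Eucl n →L[ℝ] Eucl n => L (dProj x' u)) hD
      · exact (congrArg (fun L : Eucl n →L[ℝ] Eucl n => L v) hD).symm
    exact D.injective h7
  have hu2 : mfderiv (cotModel n) 𝓘(ℝ, ℝ) (H ∘ cotLift p) x' u = (0 : ℝ) := by
    rw [mfderiv_comp x' (hs.mdifferentiable (by simp) _)
      ((contMDiff_cotLift hp).mdifferentiable (by simp) x')]
    refine Eq.trans ?_ h3
    rw [← hu]
    rfl
  have hbd := hC x' hmem u hu2
  rw [hu] at hbd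
  have hlam : lambdaForm θ x' u = ξ (mfderiv (𝓡 n) (𝓡 n) p x v) + (θ x : Eucl n →L[ℝ] ℝ) v := by
    change x'.2 (dProj x' u) + θ x (dProj x' u) = _
    rw [hu1]
    rfl
  have hsqrt : Real.sqrt (g.inner (cotLift p x') v' v') ≤ |C₁| * (K * r) :=
    (hW v').trans (mul_le_mul (le_abs_self _) h4 (norm_nonneg _) (abs_nonneg _))
  have hbd' : |lambdaForm θ x' u| ≤ |C| * (|C₁| * (K * r)) :=
    hbd.trans (mul_le_mul (le_abs_self _) hsqrt (Real.sqrt_nonneg _) (abs_nonneg _))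
  rw [hlam] at hbd'
  have htri := abs_sub (ξ (mfderiv (𝓡 n) (𝓡 n) p x v) + (θ x : Eucl n →L[ℝ] ℝ) v)
    (ξ (mfderiv (𝓡 n) (𝓡 n) p x v))
  rw [add_sub_cancel_left] at htri
  calc |(θ x : Eucl n →L[ℝ] ℝ) v| ≤ |C| * (|C₁| * (K * r)) + K * r := htri.trans (add_le_add hbd' h1)
    _ = (|C| * |C₁| * K + K) * r := by ring

end Hypersurface

/-! ### Adding the two parts of the area. -/

section Cylinders

open Set MeasureTheory

variable {n d : ℕ}
  {M : Type*} [TopologicalSpace M] [ChartedSpace (Eucl n) M] [IsManifold (𝓡 n) ∞ M]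
  {U : Type*} [TopologicalSpace U] [ChartedSpace (Eucl n) U] [IsManifold (𝓡 n) ∞ U]
  {S : Type*} [TopologicalSpace S] [ChartedSpace (Eucl d) S] [IsManifold (𝓡 d) ∞ S]

omit [IsManifold (𝓡 d) ∞ S] in
theorem cylinderIntegral_twistedForm_eq_zero {p : U → M} (hp : IsCoveringMap p)
    (hpl : IsLocalDiffeomorph (𝓡 n) (𝓡 n) ∞ p) (hps : Function.Surjective p)
    {σ : DForm (𝓡 n) M 2} {i : S → M} (hi : Manifold.IsSmoothEmbedding (𝓡 d) (𝓡 n) ∞ i)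
    {θ : OneForm (𝓡 n) U} (hθ : θ ∈ primitivesSub p σ i) (hbd : IsLocallyBoundedOver p θ)
    {f : Circle × unitInterval → Cotangent n M} (hf : IsSmoothCylinder (cotModel n) f)
    (hN : ∀ z, f (z, 0) ∈ conormal (d := d) i ∧ f (z, 1) ∈ conormal (d := d) i) :
    cylinderIntegral (twistedForm σ) f = 0 := by
  obtain ⟨hprim, b, -, ⟨C, hC⟩, hd⟩ := hθ
  have hπ := contMDiff_cotangent_proj (n := n) (N := M)
  set F := cylinderParam f with hF_def
  have hFs : ContMDiffOn 𝓘(ℝ, ℝ × ℝ) (cotModel n) ∞ F strip := contMDiffOn_cylinderParam hf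
  have hFc : Continuous F := by
    have h : Continuous f := ContMDiff.continuous hf
    unfold F cylinderParam
    fun_prop
  have hmem (y : Cotangent n M) (hy : y ∈ conormal (d := d) i) : y.proj ∈ range i := by
    obtain ⟨a, ξ, rfl, -⟩ := hy
    exact ⟨a, rfl⟩
  have hper (z : ℝ × ℝ) : (F (z + (1, 0))).proj = (F z).proj := by
    have h := cylinderParam_add_one f z.1 z.2
    have e : z + (1, 0) = (z.1 + 1, z.2) := by ext <;> simp
    rw [e]
    exact congrArg Bundle.TotalSpace.proj h
  obtain ⟨hcont, hzero⟩ := integral_pullbackWithin_eq_zero (R := range i) hp hpl hps hprim hbd hC hd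
    (u := (fun y : Cotangent n M => y.proj) ∘ F) (hπ.continuous.comp hFc) (hπ.comp_contMDiffOn hFs)
    hper
    (fun s => hmem _ (by
      simpa [hF_def, cylinderParam] using (hN (Circle.exp (2 * Real.pi * s))).1))
    (fun s => hmem _ (by
      simpa [hF_def, cylinderParam] using (hN (Circle.exp (2 * Real.pi * s))).2))
  -- Both integrands must be known to be continuous on the strip before the iterated integral of
  -- their sum can be split.
  have hcont' := continuousOn_pullbackWithin_d isSmooth_liouville hFs (1, 0) (0, 1)
  have hpt : ∀ z ∈ strip, pullbackWithin (twistedForm σ) F strip z ![(1, 0), (0, 1)] =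
      pullbackWithin (liouville (n := n) (N := M)).toDForm.d F strip z ![(1, 0), (0, 1)] +
      pullbackWithin σ ((fun y : Cotangent n M => y.proj) ∘ F) strip z ![(1, 0), (0, 1)] := by
    intro z hz
    rw [← pullbackWithin_pullback (hπ.mdifferentiable (by simp)) σ
      ((hFs z hz).mdifferentiableWithinAt (by simp)) (uniqueDiffOn_strip z hz)]
    rfl
  have hint {g : ℝ × ℝ → ℝ} (hg : ContinuousOn g strip) (s : ℝ) :
      IntervalIntegrable (fun t => g (s, t)) volume 0 1 := by
    refine ContinuousOn.intervalIntegrable ?_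
    rw [uIcc_of_le (zero_le_one' ℝ)]
    exact hg.comp (by fun_prop) fun t ht => ⟨mem_univ _, ht⟩
  rw [cylinderIntegral_eq]
  calc _ = ∫ s in (0 : ℝ)..1, ((∫ t in (0 : ℝ)..1,
          pullbackWithin (liouville (n := n) (N := M)).toDForm.d F strip (s, t) ![(1, 0), (0, 1)]) +
        ∫ t in (0 : ℝ)..1, pullbackWithin σ ((fun y : Cotangent n M => y.proj) ∘ F) strip (s, t)
          ![(1, 0), (0, 1)]) := by
        refine intervalIntegral.integral_congr fun s _ => ?_
        rw [← intervalIntegral.integral_add (hint hcont' s) (hint hcont s)]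
        refine intervalIntegral.integral_congr fun t ht => hpt _ ⟨mem_univ _, ?_⟩
        rwa [uIcc_of_le (zero_le_one' ℝ)] at ht
    _ = 0 := by
        rw [intervalIntegral.integral_add (intervalIntegrable_integral_strip hcont' 0 1)
          (intervalIntegrable_integral_strip hcont 0 1), integral_d_liouville_eq_zero hi hf hN, hzero,
          add_zero]

end Cylinders

end TwistedCotangent

end

theorem mainTheorem5 {n d : ℕ}
    {M : Type*} [TopologicalSpace M] [ChartedSpace (TwistedCotangent.Eucl n) M]
    [IsManifold (𝓡 n) ∞ M] [T2Space M] [CompactSpace M] [ConnectedSpace M]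
    {U : Type*} [TopologicalSpace U] [ChartedSpace (TwistedCotangent.Eucl n) U]
    [IsManifold (𝓡 n) ∞ U]
    {S : Type*} [TopologicalSpace S] [ChartedSpace (TwistedCotangent.Eucl d) S]
    [IsManifold (𝓡 d) ∞ S]
    (p : U → M) (hp : TwistedCotangent.IsSmoothUniversalCover (n := n) p)
    (σ : TwistedCotangent.DForm (𝓡 n) M 2) (hσ : σ.IsSmooth) (hdσ : σ.d = 0)
    (i : C(S, M)) (s₀ : S) (Sig : Set (TwistedCotangent.Cotangent n M))
    (hpair : TwistedCotangent.IsManePair (d := d) p σ i s₀ Sig ∨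
      TwistedCotangent.IsManePairCritical (d := d) p σ i s₀ Sig) :
    (∀ f : Circle × unitInterval → TwistedCotangent.Cotangent n M,
      TwistedCotangent.IsSmoothCylinder (TwistedCotangent.cotModel n) f →
      (∀ z, f (z, 0) ∈ TwistedCotangent.conormal (d := d) i ∧
        f (z, 1) ∈ TwistedCotangent.conormal (d := d) i) →
      TwistedCotangent.cylinderIntegral (TwistedCotangent.twistedForm σ) f = 0) ∧
    (∀ α : TwistedCotangent.PiS i s₀, TwistedCotangent.ConditionA (d := d) σ i s₀ α) := by
  have hU := hp.simplyConnected
  have hps := TwistedCotangent.surjective_of_isCoveringMap hp.covering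
  have key : Manifold.IsSmoothEmbedding (𝓡 d) (𝓡 n) ∞ i ∧
      ∃ θ ∈ TwistedCotangent.primitivesSub p σ i, TwistedCotangent.IsLocallyBoundedOver p θ := by
    rcases hpair with h | h
    · obtain ⟨θ, hθ, hθ'⟩ := h.nonempty
      exact ⟨h.embedding, θ, hθ', TwistedCotangent.isLocallyBoundedOver_of_mem_primitivesHyp
        hp.localDiffeo hps h.tonelli.compact h.tonelli.connected.nonempty hθ⟩
    · obtain ⟨H, hH, hc⟩ := h.critical
      exact ⟨h.embedding, TwistedCotangent.exists_isLocallyBoundedOver_of_criticalValue_neg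
        hp.localDiffeo hH.tonelli hc⟩
  obtain ⟨hi, θ, hθ, hbd⟩ := key
  have main (f : Circle × unitInterval → TwistedCotangent.Cotangent n M)
      (hf : TwistedCotangent.IsSmoothCylinder (TwistedCotangent.cotModel n) f)
      (hN : ∀ z, f (z, 0) ∈ TwistedCotangent.conormal (d := d) i ∧
        f (z, 1) ∈ TwistedCotangent.conormal (d := d) i) :
      TwistedCotangent.cylinderIntegral (TwistedCotangent.twistedForm σ) f = 0 :=
    TwistedCotangent.cylinderIntegral_twistedForm_eq_zero hp.covering hp.localDiffeo hps hi hθ hbd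
      hf hN
  -- The area vanishes for every cylinder on `N^*S`, so the class of its paths plays no role.
  exact ⟨main, fun α f hf hN _ => main f hf hN⟩
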